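/- **Setting.** There are $n$ clients joined by a time-varying directed network $\mathcal G(s)=(\{1,\dots,n\},\mathcal E(s))$, $s=0,1,2,\dots$, in which every client counts as its own in- and out-neighbour. $\mathcal N_i^{\rm in}(s)$, $\mathcal N_i^{\rm out}(s)$ denote the neighbourhoods. For some $B>0$ the graph with edge set $\bigcup_{s=tB}^{(t+1)B-1}\mathcal E(s)$ is strongly connected for every $t\ge 0$. $S$-step Push-Sum maps $(y_i)_{i=1}^n$ to $(z_i^{(S)}/\omega_i^{(S)})_{i=1}^n$, where $z_i^{(0)}=y_i$, $\omega_i^{(0)}=1$ and, for $s=1,\dots,S$, $$z_i^{(s)}=\sum_{j\in\mathcal N_i^{\rm in}(s)}\frac{z_j^{(s-1)}}{|\mathcal N_j^{\rm out}(s)|},\qquad \omega_i^{(s)}=\sum_{j\in\mathcal N_i^{\rm in}(s)}\frac{\omega_j^{(s-1)}}{|\mathcal N_j^{\rm out}(s)|}.$$ Client $i$ has a stochastic inner cost $g_i(x_i,\lambda_i;\xi_i)$ and an outer cost $f_i(x_i,\lambda_i)$, with $x_i\in\mathbb R^{d_x}$, $\lambda_i\in\mathbb R^{d_\lambda}$ and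 a random instance $\xi_i$. Write $x=[x_i]_i$, $\lambda=[\lambda_i]_i$, $\xi=(\xi_i)_i$ and $$\hat g(x,\lambda;\xi)=\sum_i g_i(x_i,\lambda_i;\xi_i),\qquad g(x,\lambda)=\sum_i\mathbb E[g_i(x_i,\lambda_i;\xi_i)],\qquad f(x,\lambda)=\sum_i f_i(x_i,\lambda_i).$$ The $f_i$ are differentiable; the $g_i(\cdot,\cdot;\xi_i)$ and their (finite) expectations are differentiable with differentiable partial gradient in $x_i$. $\partial_x^2$ is the Hessian in $x$, and $\partial^2_{x\lambda}$ is the Jacobian of $\partial_x$ with respect to $\lambda$, written as a matrix with rows indexed by $\lambda$ and columns by $x$. For every $\lambda$, $x(\lambda)$ is the solution of $\min_x g(x,\lambda)$ subject to $x_i=x_j$ for all $i,j$. The hyper-gradient $\mathrm d_\lambda f$ is the gradient of $\lambda\mapsto f(x(\lambda),\lambda)$. Derivatives written without arguments are taken at $(x(\lambda),\lambda)$. Assume that * every $g_i$ is strongly convex in $x_i$; * $\mathbb E[\partial_x^2\hat g]=\partial_x^2 g$ and $\mathbb E[\partial_{x\lambda}^2\hat g]=\partial_{x\lambda}^2 g$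 at every $(x,\lambda)$, and there are $\kappa_x,\kappa_\lambda>0$ with $\sigma_{\max}(\partial_x^2\hat g-\partial_x^2 g)\le\kappa_x$ and $\sigma_{\max}(\partial_{x\lambda}^2\hat g-\partial_{x\lambda}^2 g)\le\kappa_\lambda$ for all $x,\lambda,\xi$; * with $\alpha=\inf_{\lambda,\xi}\sigma_{\min}(\partial_x^2\hat g)$ and $\beta=\sup_{\lambda,\xi}\sigma_{\max}(\partial_{x\lambda}^2\hat g)<\infty$, both at $x=x(\lambda)$, the step size $\eta>0$ satisfies $0<\alpha<1/\eta$. **Algorithm.** Hyper-Gradient Push (HGP) with exact Hessians and Jacobians, run at $\lambda$, starts from $u_i^{(0)}=\partial_{x_i}f_i$, $v_i^{(0)}=\partial_{\lambda_i}f_i$. For $m=1,\dots,M$ it computes $(\bar u_i)_i$ by $S$-step Push-Sum from $(u_i^{(m-1)})_i$ and sets $$v_i^{(m)}=v_i^{(m-1)}-\eta\,\partial^2_{x_i\lambda_i}\mathbb E[g_i]\,\bar u_i,\qquad u_i^{(m)}=\bar u_i-\eta\,\partial^2_{x_i}\mathbb E[g_i]\,\bar u_i.$$ Its output is $v^{(M)}=[v_i^{(M)}]_i$.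 **Statement.** There are constants $0<\tau<1$ and $\delta>0$, depending only on the network, such that the following holds for all problems as above and all $\lambda$ at which $I-\eta\,\partial_x^2 g$ is positive semidefinite. The map $\lambda\mapsto f(x(\lambda),\lambda)$ is differentiable at $\lambda$, and for all integers $M\ge 0$ and $S\ge 0$ with $$S\ \ge\ \frac{\log\left(\frac{\delta}{16\sqrt n}\cdot\frac{\eta\alpha}{1-\eta\alpha}\right)}{\log\tau}$$ we have $$\|v^{(M)}-\mathrm d_\lambda f\|\ \le\ \left(\frac{2\beta}{\eta\alpha^2}\cdot\frac{8\sqrt n}{\delta}\,\tau^S+C e^{-cM}\right)\|\partial_x f\| ,$$ where $C\ge 0$ and $c>0$ depend only on $\eta,\alpha,\beta$. So, whenever $\partial_x f\ne 0$, the relative error $\|v^{(M)}-\mathrm d_\lambda f\|/\|\partial_x f\|$ is bounded deterministically by $\frac{2\beta}{\eta\alpha^2}\frac{8\sqrt n}{\delta}\tau^S+\exp(-O(M))$. -/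

import Mathlib

universe u

noncomputable section

namespace HGP

open MeasureTheory

/-! ## Singular values, partial derivatives, Hessians and mixed Jacobians -/

/-- The smallest singular value of a square matrix (as an operator): the minimum of `‖A v‖` over
unit vectors `v`. The largest singular value is the operator norm `‖A‖`. -/
def sigmaMin {X : Type*} [NormedAddCommGroup X] [NormedSpace ℝ X] (A : X →L[ℝ] X) : ℝ :=
  ⨅ v : Metric.sphere (0 : X) 1, ‖A v‖

section Derivatives

variable {X Y : Type*}
  [NormedAddCommGroup X] [InnerProductSpace ℝ X] [CompleteSpace X]
  [NormedAddCommGroup Y] [InnerProductSpace ℝ Y] [CompleteSpace Y]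

/-- The partial gradient `∂ₓ h (x, y)`. -/
def gradX (h : X → Y → ℝ) (x : X) (y : Y) : X := gradient (fun x' => h x' y) x

/-- The partial gradient `∂_y h (x, y)`. -/
def gradY (h : X → Y → ℝ) (x : X) (y : Y) : Y := gradient (fun y' => h x y') y

/-- The Hessian `∂ₓ² h (x, y)`, as an operator on the `x`-space. -/
def hessX (h : X → Y → ℝ) (x : X) (y : Y) : X →L[ℝ] X := fderiv ℝ (fun x' => gradX h x' y) x

/-- The mixed Jacobian `∂²_{xy} h (x, y)` of `∂ₓ h` with respect to `y`, as the matrix with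
`dim Y` rows and `dim X` columns, that is, the operator from the `x`-space to the `y`-space which is
the transpose of the Fréchet derivative of `y ↦ ∂ₓ h (x, y)`. -/
def jacXY (h : X → Y → ℝ) (x : X) (y : Y) : X →L[ℝ] Y :=
  ContinuousLinearMap.adjoint (fderiv ℝ (fun y' => gradX h x y') y)

/-- `h` is differentiable and its partial gradient `∂ₓ h` is differentiable, both jointly in
`(x, y)`: the Hessian and the mixed Jacobian exist as Fréchet derivatives. -/
def TwiceDiff (h : X → Y → ℝ) : Prop :=
  Differentiable ℝ (fun p : X × Y => h p.1 p.2) ∧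
    Differentiable ℝ (fun p : X × Y => gradX h p.1 p.2)

end Derivatives

/-! ## Time-varying directed networks and Push-Sum -/

section Network

variable {n : ℕ}

/-- The graph with edge set `⋃_{s = tB}^{(t+1)B-1} 𝓔(s)` is strongly connected for every `t ≥ 0`. -/
def RepeatedlyConnected (G : ℕ → Digraph (Fin n)) (B : ℕ) : Prop :=
  ∀ t : ℕ, ∀ i j : Fin n,
    Relation.ReflTransGen
      (fun a b => ∃ s, t * B ≤ s ∧ s ≤ (t + 1) * B - 1 ∧ (G s).Adj a b) i j

open Classical in
/-- The out-neighbourhood of client `i` at time `s`; every client is its own out-neighbour. -/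
def outNbrs (G : ℕ → Digraph (Fin n)) (s : ℕ) (i : Fin n) : Finset (Fin n) :=
  Finset.univ.filter (fun j => j = i ∨ (G s).Adj i j)

open Classical in
/-- The in-neighbourhood of client `i` at time `s`; every client is its own in-neighbour. -/
def inNbrs (G : ℕ → Digraph (Fin n)) (s : ℕ) (i : Fin n) : Finset (Fin n) :=
  Finset.univ.filter (fun j => j = i ∨ (G s).Adj j i)

variable {V : Type*} [AddCommGroup V] [Module ℝ V]

/-- The numerators `z_i^{(S)}` of Push-Sum: `z^{(0)} = y` and
`z_i^{(s)} = ∑_{j ∈ N_i^in(s)} z_j^{(s-1)} / |N_j^out(s)|` for `s = 1, …, S`. -/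
def pushIter (G : ℕ → Digraph (Fin n)) (y : Fin n → V) : ℕ → Fin n → V
  | 0 => y
  | s + 1 => fun i =>
      ∑ j ∈ inNbrs G (s + 1) i, ((outNbrs G (s + 1) j).card : ℝ)⁻¹ • pushIter G y s j

/-- The output `y_i^{(S)} = z_i^{(S)} / ω_i^{(S)}` of `S` steps of Push-Sum; the weights `ω_i`
follow the same recursion as the `z_i`, started at `ω_i^{(0)} = 1`. -/
def pushSum (G : ℕ → Digraph (Fin n)) (S : ℕ) (y : Fin n → V) (i : Fin n) : V :=
  (pushIter G (fun _ => (1 : ℝ)) S i)⁻¹ • pushIter G y S i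

end Network

/-! ## Bilevel decentralized federated learning -/

/-- Euclidean space `ℝ^d`. -/
abbrev Vec (d : ℕ) : Type := EuclideanSpace ℝ (Fin d)

/-- `ℝ^{nd}` with the Euclidean norm, as concatenations of `n` blocks in `ℝ^d`. -/
abbrev BlockVec (n d : ℕ) : Type := PiLp 2 (fun _ : Fin n => Vec d)

/-- The data of a bilevel decentralized federated learning problem with `n` clients: the instance
spaces, the joint law of the random instance `ξ = (ξ_1, …, ξ_n)`, the stochastic inner costs
`g_i (x_i, l_i; ξ_i)` and the outer costs `f_i (x_i, l_i)`. -/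
structure Problem (n dx dl : ℕ) : Type (u + 1) where
  Inst : Fin n → Type u
  [measInst : ∀ i, MeasurableSpace (Inst i)]
  law : Measure (∀ i, Inst i)
  [probLaw : IsProbabilityMeasure law]
  g : ∀ i, Vec dx → Vec dl → Inst i → ℝ
  f : Fin n → Vec dx → Vec dl → ℝ

attribute [instance] Problem.measInst Problem.probLaw

namespace Problem

variable {n dx dl : ℕ} (Q : Problem.{u} n dx dl)

/-- The expected inner cost `𝔼[g_i (a, b; ξ_i)]` of client `i`. -/
def meanCost (i : Fin n) (a : Vec dx) (b : Vec dl) : ℝ := ∫ ξ, Q.g i a b (ξ i) ∂Q.law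

/-- The expected total inner cost `g (x, l) = ∑_i 𝔼[g_i (x_i, l_i; ξ_i)]`. -/
def inner (x : BlockVec n dx) (l : BlockVec n dl) : ℝ := ∑ i, Q.meanCost i (x i) (l i)

/-- The sampled total inner cost `ĝ (x, l; ξ) = ∑_i g_i (x_i, l_i; ξ_i)`. -/
def sampled (ξ : ∀ i, Q.Inst i) (x : BlockVec n dx) (l : BlockVec n dl) : ℝ :=
  ∑ i, Q.g i (x i) (l i) (ξ i)

/-- The total outer cost `f (x, l) = ∑_i f_i (x_i, l_i)`. -/
def outer (x : BlockVec n dx) (l : BlockVec n dl) : ℝ := ∑ i, Q.f i (x i) (l i)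

/-- All derivatives and expectations in the problem make sense. -/
def Regular : Prop :=
  (∀ i, Differentiable ℝ (fun p : Vec dx × Vec dl => Q.f i p.1 p.2)) ∧
  (∀ i ξ, TwiceDiff (fun a b => Q.g i a b ξ)) ∧
  (∀ i a b, Integrable (fun ξ : ∀ j, Q.Inst j => Q.g i a b (ξ i)) Q.law) ∧
  (∀ i, TwiceDiff (Q.meanCost i))

/-- Every `g_i` is strongly convex in its first argument. -/
def StronglyConvex : Prop :=
  ∀ i b ξ, ∃ m : ℝ, 0 < m ∧ StrongConvexOn Set.univ m (fun a => Q.g i a b ξ)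

/-- The stochastic Hessian and mixed Jacobian are unbiased. -/
def Unbiased : Prop :=
  ∀ x l,
    (Integrable (fun ξ => hessX (Q.sampled ξ) x l) Q.law ∧
      ∫ ξ, hessX (Q.sampled ξ) x l ∂Q.law = hessX Q.inner x l) ∧
    (Integrable (fun ξ => jacXY (Q.sampled ξ) x l) Q.law ∧
      ∫ ξ, jacXY (Q.sampled ξ) x l ∂Q.law = jacXY Q.inner x l)

/-- The deviations of the stochastic Hessian and mixed Jacobian from their means are bounded. -/
def BoundedNoise : Prop :=
  ∃ κx κl : ℝ, 0 < κx ∧ 0 < κl ∧ ∀ x l ξ,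
    ‖hessX (Q.sampled ξ) x l - hessX Q.inner x l‖ ≤ κx ∧
    ‖jacXY (Q.sampled ξ) x l - jacXY Q.inner x l‖ ≤ κl

/-- `x` minimizes the expected total inner cost under the consensus constraint. -/
def IsSolution (x : BlockVec n dx) (l : BlockVec n dl) : Prop :=
  (∀ i j, x i = x j) ∧
    ∀ y : BlockVec n dx, (∀ i j, y i = y j) → Q.inner x l ≤ Q.inner y l

/-- The hyper-gradient: the total derivative of `l ↦ f (x(l), l)`. -/
def hyperGrad (xs : BlockVec n dl → BlockVec n dx) (l : BlockVec n dl) : BlockVec n dl :=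
  gradient (fun l' => Q.outer (xs l') l') l

/-- The iterates `(u^{(m)}, v^{(m)})` of Hyper-Gradient Push with `S` Push-Sum steps per iteration,
run at `(x, l)` with the exact Hessians and mixed Jacobians of the expected costs. -/
def exactHGP (G : ℕ → Digraph (Fin n)) (η : ℝ) (S : ℕ)
    (x : BlockVec n dx) (l : BlockVec n dl) : ℕ → (Fin n → Vec dx) × (Fin n → Vec dl)
  | 0 => (fun i => gradX (Q.f i) (x i) (l i), fun i => gradY (Q.f i) (x i) (l i))
  | m + 1 =>
      let uv := exactHGP G η S x l m
      let ubar := pushSum G S uv.1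
      (fun i => ubar i - η • hessX (Q.meanCost i) (x i) (l i) (ubar i),
       fun i => uv.2 i - η • jacXY (Q.meanCost i) (x i) (l i) (ubar i))

/-- The output `v^{(M)} ∈ ℝ^{n dl}` of exact Hyper-Gradient Push after `M` iterations. -/
def estimate (G : ℕ → Digraph (Fin n)) (η : ℝ) (S M : ℕ)
    (x : BlockVec n dx) (l : BlockVec n dl) : BlockVec n dl :=
  WithLp.toLp 2 (Q.exactHGP G η S x l M).2

end Problem

end HGP

end

noncomputable section

namespace HGP

open MeasureTheory

/-! ## Push-Sum converges geometrically to the average -/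

section PushSum

variable {n : ℕ}

/-! Let P be the orthogonal projection onto the consensus space K, and H, J the Hessian and mixed
Jacobian of the mean inner cost at (x(λ), λ). The derivative D of x(·) takes values in K and
satisfies ⟨H D w, k⟩ = -⟨Jᵀ w, k⟩ for k in K. Hence d_λ f = ∂_λ f - η J s, where s in K solves η P H
s = P ∂ₓf (`exists_hasGradientAt_outer`). The gradient need not be C¹, so differentiability of x(·)
comes from convexity rather than from the implicit function theorem
(`exists_hasFDerivAt_minimizer`).

The equation for s reads s = P ∂ₓf + P (I - ηH) s, a Neumann series. HGP sums the first M terms of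
this series with Push-Sum in place of P (`estimate_eq`), so its error is at most ηβ times the error
of that sum. Averaging the sampled Hessians makes H coercive with constant α; together with
positivity of I - ηH this gives ‖I - ηH‖ ≤ 1 - ηα. Truncation then costs (1 - ηα)^M / (ηα). If
Push-Sum is within ε of P and (1 - ηα)(1 + ε) ≤ 1 - ηα/2, the perturbed iteration still contracts
and the perturbations add up to at most 2ε/(ηα)² (`norm_sum_sub_le_of_inexact_projection`).

Finally ε = O(τ^S): after division by the weights, Push-Sum is a product of row-stochastic matrices.
Over 2Bn steps their entries are bounded away from zero, which shrinks the range of every column,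
and a conserved weighted mean identifies the limit 1/n (`exists_pushMatrix_sub_le`). -/

open Classical in
/-- The column-stochastic mixing matrix of a Push-Sum step at time `s`. -/
def mixing (G : ℕ → Digraph (Fin n)) (s : ℕ) : Matrix (Fin n) (Fin n) ℝ :=
  Matrix.of fun i j => if j ∈ inNbrs G s i then ((outNbrs G s j).card : ℝ)⁻¹ else 0

/-- The product of the mixing matrices at the times `s + 1, …, s + k`. -/
def mixProd (G : ℕ → Digraph (Fin n)) (s : ℕ) : ℕ → Matrix (Fin n) (Fin n) ℝ
  | 0 => 1
  | k + 1 => mixing G (s + k + 1) * mixProd G s k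

variable (G : ℕ → Digraph (Fin n))

lemma mem_inNbrs_iff (s : ℕ) (i j : Fin n) : j ∈ inNbrs G s i ↔ i ∈ outNbrs G s j := by
  simp [inNbrs, outNbrs, eq_comm]

lemma outNbrs_card_pos (s : ℕ) (j : Fin n) : 0 < (outNbrs G s j).card :=
  Finset.card_pos.2 ⟨j, by simp [outNbrs]⟩

lemma mixing_nonneg (s : ℕ) (i j : Fin n) : 0 ≤ mixing G s i j := by
  simp only [mixing, Matrix.of_apply]
  split_ifs <;> positivity

lemma inv_le_mixing {s : ℕ} {i j : Fin n} (h : j ∈ inNbrs G s i) :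
    (n : ℝ)⁻¹ ≤ mixing G s i j := by
  simp only [mixing, Matrix.of_apply, if_pos h]
  apply inv_anti₀
  · exact_mod_cast outNbrs_card_pos G s j
  · have := Finset.card_le_univ (outNbrs G s j)
    rw [Fintype.card_fin] at this
    exact_mod_cast this

lemma sum_mixing (s : ℕ) (j : Fin n) : ∑ i, mixing G s i j = 1 := by
  simp only [mixing, Matrix.of_apply, mem_inNbrs_iff, Finset.sum_ite_mem, Finset.univ_inter,
    Finset.sum_const, nsmul_eq_mul]
  exact mul_inv_cancel₀ (by exact_mod_cast (outNbrs_card_pos G s j).ne')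

lemma mixProd_nonneg (s k : ℕ) (i j : Fin n) : 0 ≤ mixProd G s k i j := by
  induction k generalizing i with
  | zero => simp only [mixProd, Matrix.one_apply]; split_ifs <;> norm_num
  | succ k ih =>
    simp only [mixProd, Matrix.mul_apply]
    exact Finset.sum_nonneg fun l _ => mul_nonneg (mixing_nonneg G _ _ _) (ih l)

lemma sum_mixProd (s k : ℕ) (j : Fin n) : ∑ i, mixProd G s k i j = 1 := by
  induction k with
  | zero => simp [mixProd, Matrix.one_apply]
  | succ k ih =>
    simp only [mixProd, Matrix.mul_apply]
    rw [Finset.sum_comm]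
    simp only [← Finset.sum_mul, sum_mixing, one_mul, ih]

lemma mixProd_add (s k l : ℕ) : mixProd G s (k + l) = mixProd G (s + k) l * mixProd G s k := by
  induction l with
  | zero => simp [mixProd]
  | succ l ih =>
    rw [← add_assoc]
    simp only [mixProd, ih, Matrix.mul_assoc, ← add_assoc]

lemma mixing_mul_le (s k : ℕ) (i j l : Fin n) :
    mixing G (s + k + 1) i l * mixProd G s k l j ≤ mixProd G s (k + 1) i j := by
  simp only [mixProd, Matrix.mul_apply]
  exact Finset.single_le_sum (f := fun l => mixing G (s + k + 1) i l * mixProd G s k l j)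
    (fun l _ => mul_nonneg (mixing_nonneg G _ _ _) (mixProd_nonneg G _ _ _ _)) (Finset.mem_univ l)

lemma mixProd_step {s k : ℕ} {i j l : Fin n} (hl : l ∈ inNbrs G (s + k + 1) i)
    (h : ((n : ℝ)⁻¹) ^ k ≤ mixProd G s k l j) : ((n : ℝ)⁻¹) ^ (k + 1) ≤ mixProd G s (k + 1) i j := by
  refine le_trans ?_ (mixing_mul_le G s k i j l)
  rw [pow_succ']
  exact mul_le_mul (inv_le_mixing G hl) h (by positivity) (mixing_nonneg G _ _ _)

/-- Self-loops retain at least the fraction 1/n of the mass at each step. -/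
lemma mixProd_stay {s k : ℕ} {i j : Fin n} (m : ℕ)
    (h : ((n : ℝ)⁻¹) ^ k ≤ mixProd G s k i j) : ((n : ℝ)⁻¹) ^ (k + m) ≤ mixProd G s (k + m) i j := by
  induction m with
  | zero => exact h
  | succ m ih => exact mixProd_step G (by simp [inNbrs]) ih

lemma inv_pow_le_mixProd_self (s k : ℕ) (i : Fin n) : ((n : ℝ)⁻¹) ^ k ≤ mixProd G s k i i := by
  simpa using mixProd_stay G (s := s) (k := 0) (i := i) (j := i) k (by simp [mixProd])

/-! ### Spread of mass through the network -/

open Classical in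
/-- The clients that the mass of client `j` at time `s` has reached `k` steps later. -/
def reached (s k : ℕ) (j : Fin n) : Finset (Fin n) :=
  Finset.univ.filter fun i => ((n : ℝ)⁻¹) ^ k ≤ mixProd G s k i j

lemma mem_reached {s k : ℕ} {i j : Fin n} :
    i ∈ reached G s k j ↔ ((n : ℝ)⁻¹) ^ k ≤ mixProd G s k i j := by
  simp [reached]

lemma reached_mono (s j) {k l : ℕ} (h : k ≤ l) : reached G s k j ⊆ reached G s l j := by
  obtain ⟨m, rfl⟩ := Nat.exists_eq_add_of_le h
  intro i hi
  rw [mem_reached] at hi ⊢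
  exact mixProd_stay G m hi

lemma exists_edge_of_reflTransGen {α : Type*} {r : α → α → Prop} {A : Set α} {a b : α}
    (h : Relation.ReflTransGen r a b) (ha : a ∈ A) (hb : b ∉ A) :
    ∃ c d, c ∈ A ∧ d ∉ A ∧ r c d := by
  induction h with
  | refl => exact absurd ha hb
  | tail h hr ih =>
    rename_i c d
    by_cases hc : c ∈ A
    · exact ⟨c, d, hc, hb, hr⟩
    · exact ih hc

variable {G} {B : ℕ}

lemma reached_grow (hB : 0 < B) (hG : RepeatedlyConnected G B) (s k : ℕ) (j : Fin n)
    (h : reached G s k j ≠ Finset.univ) :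
    reached G s k j ⊂ reached G s (k + 2 * B) j := by
  refine (Finset.ssubset_iff_of_subset (reached_mono G s j (by omega))).2 ?_
  obtain ⟨b, hb⟩ : ∃ b, b ∉ reached G s k j := by
    by_contra! hc
    exact h (Finset.eq_univ_iff_forall.2 hc)
  have hj : j ∈ reached G s k j := (mem_reached G).2 (inv_pow_le_mixProd_self G s k j)
  -- Window number (s + k) / B + 1 is the first to start after time s + k, and it ends before s + k
  -- + 2B. A path in it from `j` to the unreached `b` has an edge leaving the reached set.
  obtain ⟨c, d, hc, hd, t, ht1, ht2, hadj⟩ := exists_edge_of_reflTransGen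
    (A := {i | i ∈ reached G s k j}) (hG ((s + k) / B + 1) j b) hj hb
  have h1 : s + k < ((s + k) / B + 1) * B := by
    have := Nat.lt_div_mul_add (a := s + k) hB
    rw [add_mul, one_mul]; exact this
  have h2 : ((s + k) / B + 1 + 1) * B ≤ s + k + 2 * B := by
    have := Nat.div_mul_le_self (s + k) B
    rw [add_mul, add_mul, one_mul]; omega
  obtain ⟨m, rfl⟩ : ∃ m, t = s + (k + m) + 1 := ⟨t - (s + k) - 1, by omega⟩
  refine ⟨d, reached_mono G s j (k := k + m + 1) (by omega) ?_, hd⟩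
  rw [mem_reached]
  refine mixProd_step G (l := c) ?_ ((mem_reached G).1 (reached_mono G s j (by omega) hc))
  simp [inNbrs, hadj]

/-- Every stretch of 2B steps adds a client until none is missing, so n stretches suffice. -/
lemma reached_card (hB : 0 < B) (hG : RepeatedlyConnected G B) (s : ℕ) (j : Fin n) (k : ℕ) :
    min n k ≤ (reached G s (k * (2 * B)) j).card := by
  induction k with
  | zero => simp
  | succ k ih =>
    by_cases h : reached G s (k * (2 * B)) j = Finset.univ
    · have h' := Finset.card_le_card (reached_mono G s j
        (show k * (2 * B) ≤ (k + 1) * (2 * B) by rw [add_mul]; omega))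
      rw [h, Finset.card_univ, Fintype.card_fin] at h'
      exact (min_le_left _ _).trans h'
    · have h' := Finset.card_lt_card (reached_grow hB hG s _ j h)
      rw [add_mul, one_mul]
      omega

/-- After sufficiently many steps every entry of the mixing product is bounded below. -/
lemma inv_pow_le_mixProd (hB : 0 < B) (hG : RepeatedlyConnected G B) (s : ℕ) (i j : Fin n) :
    ((n : ℝ)⁻¹) ^ (n * (2 * B)) ≤ mixProd G s (n * (2 * B)) i j := by
  have h := reached_card hB hG s j n
  rw [min_self] at h
  have h' : reached G s (n * (2 * B)) j = Finset.univ :=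
    Finset.eq_univ_of_card _ (le_antisymm (Finset.card_le_univ _) (by simpa using h))
  rw [← mem_reached, h']
  exact Finset.mem_univ i

/-! ### Weights and normalized Push-Sum matrices -/

variable (G)

lemma pushIter_eq_sum {V : Type*} [AddCommGroup V] [Module ℝ V] (y : Fin n → V) (s : ℕ)
    (i : Fin n) : pushIter G y s i = ∑ j, mixProd G 0 s i j • y j := by
  induction s generalizing i with
  | zero => simp [pushIter, mixProd, Matrix.one_apply]
  | succ s ih =>
    simp only [pushIter, mixProd, Matrix.mul_apply, Finset.sum_smul, mul_smul, zero_add]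
    rw [Finset.sum_comm]
    simp only [← Finset.smul_sum, ← ih]
    simp only [mixing, Matrix.of_apply, ite_smul, zero_smul, Finset.sum_ite_mem,
      Finset.univ_inter]

/-- The Push-Sum weight of client `i` after `s` steps. -/
def weight (s : ℕ) (i : Fin n) : ℝ := ∑ j, mixProd G 0 s i j

/-- The row-stochastic matrix of `s` steps of Push-Sum. -/
def pushMatrix (s : ℕ) (i j : Fin n) : ℝ := (weight G s i)⁻¹ * mixProd G 0 s i j

lemma pushSum_eq_sum {V : Type*} [AddCommGroup V] [Module ℝ V] (y : Fin n → V) (s : ℕ)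
    (i : Fin n) : pushSum G s y i = ∑ j, pushMatrix G s i j • y j := by
  simp [pushSum, pushIter_eq_sum, pushMatrix, weight, mul_smul, Finset.smul_sum]

lemma weight_add (s k : ℕ) (i : Fin n) :
    weight G (s + k) i = ∑ j, mixProd G s k i j * weight G s j := by
  simp only [weight, mixProd_add, Matrix.mul_apply, Finset.mul_sum, zero_add]
  rw [Finset.sum_comm]

lemma sum_weight (s : ℕ) : ∑ i, weight G s i = n := by
  exact Finset.sum_comm.trans (by simp [sum_mixProd])

lemma weight_nonneg (s : ℕ) (i : Fin n) : 0 ≤ weight G s i :=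
  Finset.sum_nonneg fun j _ => mixProd_nonneg G 0 s i j

lemma weight_le (s : ℕ) (i : Fin n) : weight G s i ≤ n := by
  rw [← sum_weight G s]
  exact Finset.single_le_sum (fun j _ => weight_nonneg G s j) (Finset.mem_univ i)

lemma weight_pos (s : ℕ) (i : Fin n) : 0 < weight G s i := by
  have hn : 0 < n := i.pos
  refine lt_of_lt_of_le (by positivity : 0 < ((n : ℝ)⁻¹) ^ s) ?_
  exact (inv_pow_le_mixProd_self G 0 s i).trans
    (Finset.single_le_sum (fun j _ => mixProd_nonneg G 0 s i j) (Finset.mem_univ i))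

variable {G}

/-- Early on, a client's own initial mass suffices; later, the last 2Bn steps bring it a fixed
fraction of the total mass n. -/
lemma inv_pow_le_weight (hB : 0 < B) (hG : RepeatedlyConnected G B) (s : ℕ) (i : Fin n) :
    ((n : ℝ)⁻¹) ^ (n * (2 * B)) ≤ weight G s i := by
  have hn : (1 : ℝ) ≤ n := by exact_mod_cast i.pos
  have hn' : (n : ℝ)⁻¹ ≤ 1 := inv_le_one_of_one_le₀ hn
  rcases le_total s (n * (2 * B)) with h | h
  · refine (pow_le_pow_of_le_one (by positivity) hn' h).trans ?_
    exact (inv_pow_le_mixProd_self G 0 s i).trans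
      (Finset.single_le_sum (fun j _ => mixProd_nonneg G 0 s i j) (Finset.mem_univ i))
  · obtain ⟨t, rfl⟩ := Nat.exists_eq_add_of_le' h
    rw [weight_add]
    calc ((n : ℝ)⁻¹) ^ (n * (2 * B)) ≤ ((n : ℝ)⁻¹) ^ (n * (2 * B)) * n :=
          le_mul_of_one_le_right (by positivity) hn
      _ = ∑ j, ((n : ℝ)⁻¹) ^ (n * (2 * B)) * weight G t j := by
          rw [← Finset.mul_sum, sum_weight]
      _ ≤ _ := Finset.sum_le_sum fun j _ => mul_le_mul_of_nonneg_right
          (inv_pow_le_mixProd hB hG t i j) (weight_nonneg G t j)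

variable (G)

/-- The row-stochastic transition matrix between the normalized states at times `s` and `s + k`. -/
def transition (s k : ℕ) (i j : Fin n) : ℝ :=
  (weight G (s + k) i)⁻¹ * mixProd G s k i j * weight G s j

lemma transition_nonneg (s k : ℕ) (i j : Fin n) : 0 ≤ transition G s k i j :=
  mul_nonneg (mul_nonneg (inv_nonneg.2 (weight_nonneg G _ _)) (mixProd_nonneg G _ _ _ _))
    (weight_nonneg G _ _)

lemma sum_transition (s k : ℕ) (i : Fin n) : ∑ j, transition G s k i j = 1 := by
  simp only [transition, mul_assoc]
  rw [← Finset.mul_sum, ← weight_add]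
  exact inv_mul_cancel₀ (weight_pos G _ i).ne'

/-- Normalizing by the weights turns the column-stochastic recursion into averaging by
row-stochastic matrices, which can only shrink the range of a column. -/
lemma pushMatrix_add (s k : ℕ) (i j : Fin n) :
    pushMatrix G (s + k) i j = ∑ l, transition G s k i l * pushMatrix G s l j := by
  simp only [pushMatrix, transition, mixProd_add, Matrix.mul_apply, Finset.mul_sum, zero_add]
  refine Finset.sum_congr rfl fun l _ => ?_
  have := (weight_pos G s l).ne'
  field_simp

lemma sum_pushMatrix (s : ℕ) (i : Fin n) : ∑ j, pushMatrix G s i j = 1 := by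
  simp only [pushMatrix]
  rw [← Finset.mul_sum]
  exact inv_mul_cancel₀ (weight_pos G _ i).ne'

lemma sum_weight_mul_pushMatrix (s : ℕ) (j : Fin n) :
    ∑ i, weight G s i * pushMatrix G s i j = 1 := by
  rw [← sum_mixProd G 0 s j]
  refine Finset.sum_congr rfl fun i _ => ?_
  rw [pushMatrix, mul_inv_cancel_left₀ (weight_pos G s i).ne']

/-- A row-stochastic matrix with entries at least `θ` contracts intervals by `1 - n θ`. -/
lemma stochastic_contract {q r : Fin n → ℝ} {θ a b : ℝ} (hq : ∀ j, θ ≤ q j) (hs : ∑ j, q j = 1)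
    (ha : ∀ j, a ≤ r j) (hb : ∀ j, r j ≤ b) :
    (1 - n * θ) * a + θ * ∑ j, r j ≤ ∑ j, q j * r j ∧
      ∑ j, q j * r j ≤ (1 - n * θ) * b + θ * ∑ j, r j := by
  have key : ∀ c : ℝ, ∑ j, (q j - θ) * (r j - c)
      = ∑ j, q j * r j - θ * ∑ j, r j - (1 - n * θ) * c := by
    intro c
    have : ∀ j, (q j - θ) * (r j - c) = q j * r j - θ * r j - (q j * c - θ * c) := fun j => by ring
    simp only [this, Finset.sum_sub_distrib, ← Finset.mul_sum, ← Finset.sum_mul, hs]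
    simp
    ring
  have h1 : 0 ≤ ∑ j, (q j - θ) * (r j - a) := Finset.sum_nonneg fun j _ =>
    mul_nonneg (sub_nonneg.2 (hq j)) (sub_nonneg.2 (ha j))
  have h2 : ∑ j, (q j - θ) * (r j - b) ≤ 0 := Finset.sum_nonpos fun j _ =>
    mul_nonpos_of_nonneg_of_nonpos (sub_nonneg.2 (hq j)) (sub_nonpos.2 (hb j))
  rw [key] at h1 h2
  constructor <;> linarith

variable {G}

lemma exists_pushMatrix_contract (hn : 0 < n) (hB : 0 < B) (hG : RepeatedlyConnected G B) :
    ∃ γ : ℝ, 0 < γ ∧ γ < 1 ∧ ∀ s j a b, (∀ i, a ≤ pushMatrix G s i j) →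
      (∀ i, pushMatrix G s i j ≤ b) → ∃ a' b', b' - a' = γ * (b - a) ∧
        (∀ i, a' ≤ pushMatrix G (s + n * (2 * B)) i j) ∧
        ∀ i, pushMatrix G (s + n * (2 * B)) i j ≤ b' := by
  have hn' : (0 : ℝ) < n := by exact_mod_cast hn
  have hn1 : (n : ℝ)⁻¹ ≤ 1 := inv_le_one_of_one_le₀ (by exact_mod_cast hn)
  set p : ℝ := ((n : ℝ)⁻¹) ^ (n * (2 * B)) with hp
  have hp0 : 0 < p := by positivity
  have hp1 : p ≤ 1 := pow_le_one₀ (by positivity) hn1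
  -- The factors bound the inverse weight, the mixing entry and the weight in `transition`. Halving
  -- keeps γ = 1 - nθ positive even for n = 1, where p = 1.
  set θ : ℝ := (n : ℝ)⁻¹ * (p * p) / 2 with hθ
  have hnθ : n * θ = p * p / 2 := by rw [hθ]; field_simp
  have hpp : p * p ≤ 1 := mul_le_one₀ hp1 hp0.le hp1
  refine ⟨1 - n * θ, by rw [hnθ]; linarith, by rw [hnθ]; nlinarith, fun s j a b ha hb => ?_⟩
  have hq : ∀ i l, θ ≤ transition G s (n * (2 * B)) i l := by
    intro i l
    have h1 : (n : ℝ)⁻¹ ≤ (weight G (s + n * (2 * B)) i)⁻¹ :=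
      inv_anti₀ (weight_pos G _ i) (weight_le G _ i)
    have h2 := inv_pow_le_mixProd hB hG s i l
    have h3 := inv_pow_le_weight hB hG s l
    calc θ ≤ (n : ℝ)⁻¹ * p * p := by
          rw [hθ, mul_assoc]
          linarith [show 0 ≤ (n : ℝ)⁻¹ * (p * p) by positivity]
      _ ≤ transition G s (n * (2 * B)) i l := by
        refine mul_le_mul (mul_le_mul h1 h2 hp0.le ?_) h3 hp0.le ?_
        · exact inv_nonneg.2 (weight_nonneg G _ _)
        · exact mul_nonneg (inv_nonneg.2 (weight_nonneg G _ _)) (mixProd_nonneg G _ _ _ _)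
  refine ⟨(1 - n * θ) * a + θ * ∑ i, pushMatrix G s i j,
    (1 - n * θ) * b + θ * ∑ i, pushMatrix G s i j, by ring, fun i => ?_, fun i => ?_⟩
  · rw [pushMatrix_add]
    exact (stochastic_contract (hq i) (sum_transition G s _ i) ha hb).1
  · rw [pushMatrix_add]
    exact (stochastic_contract (hq i) (sum_transition G s _ i) ha hb).2

/-- The matrix of `s` steps of Push-Sum converges geometrically to the averaging matrix. -/
theorem exists_pushMatrix_sub_le (hn : 0 < n) (hB : 0 < B) (hG : RepeatedlyConnected G B) :
    ∃ C τ : ℝ, 0 < C ∧ 0 < τ ∧ τ < 1 ∧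
      ∀ s i j, |pushMatrix G s i j - (n : ℝ)⁻¹| ≤ C * τ ^ s := by
  obtain ⟨γ, hγ0, hγ1, hγ⟩ := exists_pushMatrix_contract hn hB hG
  set K := n * (2 * B) with hK
  have hKpos : 0 < K := by positivity
  have hn' : (0 : ℝ) < n := by exact_mod_cast hn
  have base : ∀ k j, ∃ a b, b - a = γ ^ k ∧ (∀ i, a ≤ pushMatrix G (k * K) i j) ∧
      ∀ i, pushMatrix G (k * K) i j ≤ b := by
    intro k j
    induction k with
    | zero =>
      refine ⟨0, 1, by simp, fun i => ?_, fun i => ?_⟩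
      · exact mul_nonneg (inv_nonneg.2 (weight_nonneg G _ _)) (mixProd_nonneg G _ _ _ _)
      · rw [← sum_pushMatrix G (0 * K) i]
        exact Finset.single_le_sum (f := fun j => pushMatrix G (0 * K) i j)
          (fun l _ => mul_nonneg (inv_nonneg.2 (weight_nonneg G _ _)) (mixProd_nonneg G _ _ _ _))
          (Finset.mem_univ j)
    | succ k ih =>
      obtain ⟨a, b, hab, ha, hb⟩ := ih
      obtain ⟨a', b', hab', ha', hb'⟩ := hγ _ j a b ha hb
      refine ⟨a', b', by rw [hab', hab, pow_succ'], ?_, ?_⟩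
      · rw [add_mul, one_mul]; exact ha'
      · rw [add_mul, one_mul]; exact hb'
  have bound : ∀ s i j, |pushMatrix G s i j - (n : ℝ)⁻¹| ≤ γ ^ (s / K) := by
    intro s i j
    obtain ⟨a, b, hab, ha, hb⟩ := base (s / K) j
    have hs : s = s / K * K + s % K := (Nat.div_add_mod' s K).symm
    -- With θ = 0 the contraction lemma says that averages stay in [a, b]; this covers the remaining
    -- s % K steps.
    have ha' : ∀ i, a ≤ pushMatrix G s i j := fun i => by
      rw [hs, pushMatrix_add]
      simpa using (stochastic_contract (θ := 0) (transition_nonneg G _ _ i)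
        (sum_transition G _ _ i) ha hb).1
    have hb' : ∀ i, pushMatrix G s i j ≤ b := fun i => by
      rw [hs, pushMatrix_add]
      simpa using (stochastic_contract (θ := 0) (transition_nonneg G _ _ i)
        (sum_transition G _ _ i) ha hb).2
    -- The weights sum to n and the weighted column sum is 1, so the weighted mean of the column,
    -- which lies in [a, b], is 1/n.
    have h1 : n * a ≤ 1 := by
      rw [← sum_weight_mul_pushMatrix G s j, ← sum_weight G s, Finset.sum_mul]
      exact Finset.sum_le_sum fun i _ => mul_le_mul_of_nonneg_left (ha' i) (weight_nonneg G s i)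
    have h2 : 1 ≤ n * b := by
      rw [← sum_weight_mul_pushMatrix G s j, ← sum_weight G s, Finset.sum_mul]
      exact Finset.sum_le_sum fun i _ => mul_le_mul_of_nonneg_left (hb' i) (weight_nonneg G s i)
    have h1' : a ≤ (n : ℝ)⁻¹ := by rw [← one_div, le_div_iff₀ hn']; linarith
    have h2' : (n : ℝ)⁻¹ ≤ b := by rw [← one_div, div_le_iff₀ hn']; linarith
    rw [abs_le, ← hab]
    constructor <;> linarith [ha' i, hb' i]
  -- The factor γ⁻¹ pays for rounding s / K down.
  refine ⟨γ⁻¹, γ ^ ((K : ℝ)⁻¹), by positivity, by positivity,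
    Real.rpow_lt_one hγ0.le hγ1 (by positivity), fun s i j => (bound s i j).trans ?_⟩
  rw [← Real.rpow_natCast (γ ^ ((K : ℝ)⁻¹)), ← Real.rpow_mul hγ0.le, ← Real.rpow_neg_one,
    ← Real.rpow_add hγ0, ← Real.rpow_natCast]
  refine Real.rpow_le_rpow_of_exponent_ge hγ0 hγ1.le ?_
  have h : s < (s / K + 1) * K := by
    rw [add_mul, one_mul]; exact Nat.lt_div_mul_add hKpos
  have h' : (s : ℝ) < ((s / K : ℕ) + 1) * K := by exact_mod_cast h
  have hK' : (0 : ℝ) < K := by exact_mod_cast hKpos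
  have : (K : ℝ)⁻¹ * s < (s / K : ℕ) + 1 := by
    rw [inv_mul_lt_iff₀ hK', mul_comm]; exact h'
  linarith

end PushSum

/-! ## Gradients, Hessians and implicit differentiation of constrained minimizers -/

section Calculus

set_option linter.unusedSectionVars false

open InnerProductSpace Topology Filter

variable {X Y : Type*}
  [NormedAddCommGroup X] [InnerProductSpace ℝ X] [CompleteSpace X]
  [NormedAddCommGroup Y] [InnerProductSpace ℝ Y] [CompleteSpace Y]
  {h : X → Y → ℝ}

lemma hasGradientAt_gradX (hh : Differentiable ℝ (fun p : X × Y => h p.1 p.2)) (x : X) (y : Y) :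
    HasGradientAt (fun x' => h x' y) (gradX h x y) x := by
  have : DifferentiableAt ℝ (fun x' => h x' y) x :=
    (hh (x, y)).comp x (f := fun x' => (x', y)) (by fun_prop)
  exact this.hasGradientAt

lemma hasGradientAt_gradY (hh : Differentiable ℝ (fun p : X × Y => h p.1 p.2)) (x : X) (y : Y) :
    HasGradientAt (fun y' => h x y') (gradY h x y) y := by
  have : DifferentiableAt ℝ (fun y' => h x y') y :=
    (hh (x, y)).comp y (f := fun y' => (x, y')) (by fun_prop)
  exact this.hasGradientAt

lemma fderiv_apply_eq_inner (hh : Differentiable ℝ (fun p : X × Y => h p.1 p.2)) (x : X) (y : Y)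
    (a : X) (b : Y) : fderiv ℝ (fun p : X × Y => h p.1 p.2) (x, y) (a, b)
      = inner ℝ (gradX h x y) a + inner ℝ (gradY h x y) b := by
  have hd := (hh (x, y)).hasFDerivAt
  have h1 := (hasGradientAt_gradX hh x y).hasFDerivAt.unique
    (hd.comp x (f := fun x' => (x', y)) (hasFDerivAt_prodMk_left x y))
  have h2 := (hasGradientAt_gradY hh x y).hasFDerivAt.unique
    (hd.comp y (f := fun y' => (x, y')) (hasFDerivAt_prodMk_right x y))
  have h1' := congrArg (fun L => L a) h1
  have h2' := congrArg (fun L => L b) h2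
  simp only [toDual_apply_apply, ContinuousLinearMap.comp_apply] at h1' h2'
  rw [h1', h2', ← map_add]
  simp

namespace TwiceDiff

lemma hasFDerivAt_gradX (hh : TwiceDiff h) (x : X) (y : Y) :
    HasFDerivAt (fun p : X × Y => gradX h p.1 p.2)
      ((hessX h x y).comp (ContinuousLinearMap.fst ℝ X Y)
        + (ContinuousLinearMap.adjoint (jacXY h x y)).comp (ContinuousLinearMap.snd ℝ X Y))
      (x, y) := by
  have hd := (hh.2 (x, y)).hasFDerivAt
  have h1 := (hd.comp x (f := fun x' => (x', y)) (hasFDerivAt_prodMk_left x y)).fderiv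
  have h2 := (hd.comp y (f := fun y' => (x, y')) (hasFDerivAt_prodMk_right x y)).fderiv
  convert hd using 1
  refine ContinuousLinearMap.ext fun p => ?_
  simp only [hessX, jacXY, ContinuousLinearMap.adjoint_adjoint]
  simp only [Function.comp_def] at h1 h2
  rw [h1, h2]
  obtain ⟨a, b⟩ := p
  simp [← map_add]

lemma hasFDerivAt_hessX (hh : TwiceDiff h) (x : X) (y : Y) :
    HasFDerivAt (fun x' => gradX h x' y) (hessX h x y) x := by
  have : DifferentiableAt ℝ (fun x' => gradX h x' y) x :=
    (hh.2 (x, y)).comp x (f := fun x' => (x', y)) (by fun_prop)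
  exact this.hasFDerivAt

lemma hasFDerivAt_adjoint_jacXY (hh : TwiceDiff h) (x : X) (y : Y) :
    HasFDerivAt (fun y' => gradX h x y') (ContinuousLinearMap.adjoint (jacXY h x y)) y := by
  have : DifferentiableAt ℝ (fun y' => gradX h x y') y :=
    (hh.2 (x, y)).comp y (f := fun y' => (x, y')) (by fun_prop)
  rw [jacXY, ContinuousLinearMap.adjoint_adjoint]
  exact this.hasFDerivAt

/-- Symmetry of second derivatives needs only differentiability of the gradient, not continuity of
the Hessian. -/
lemma inner_hessX_comm (hh : TwiceDiff h) (x : X) (y : Y) (v w : X) :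
    inner ℝ (hessX h x y v) w = inner ℝ v (hessX h x y w) := by
  have h1 : ∀ x', HasFDerivAt (fun x' => h x' y)
      ((toDualMap ℝ X).toContinuousLinearMap (gradX h x' y)) x' :=
    fun x' => (hasGradientAt_gradX hh.1 x' y).hasFDerivAt
  have h2 := ((toDualMap ℝ X).toContinuousLinearMap.hasFDerivAt
    (x := gradX h x y)).comp x (hh.hasFDerivAt_hessX x y)
  have := second_derivative_symmetric h1 h2 v w
  simp only [ContinuousLinearMap.comp_apply, LinearIsometry.coe_toContinuousLinearMap,
    toDualMap_apply_apply] at this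
  rw [this, real_inner_comm]

end TwiceDiff

lemma hasDerivAt_line (hh : Differentiable ℝ (fun p : X × Y => h p.1 p.2)) (x v : X) (y : Y)
    (t : ℝ) : HasDerivAt (fun t : ℝ => h (x + t • v) y) (inner ℝ (gradX h (x + t • v) y) v) t := by
  have hl : HasDerivAt (fun t : ℝ => x + t • v) v t := by
    simpa using ((hasDerivAt_id t).smul_const v).const_add x
  have := (hasGradientAt_gradX hh (x + t • v) y).hasFDerivAt.comp_hasDerivAt t hl
  simpa [Function.comp_def] using this

/-- On a line, the derivative of a convex function is monotone. -/
lemma monotone_inner_gradX (hh : Differentiable ℝ (fun p : X × Y => h p.1 p.2)) {y : Y}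
    (hc : ConvexOn ℝ Set.univ (fun x => h x y)) (x v : X) :
    Monotone (fun t : ℝ => inner ℝ (gradX h (x + t • v) y) v) := by
  have hc' : ConvexOn ℝ Set.univ (fun t : ℝ => h (x + t • v) y) := by
    have := hc.comp_affineMap (AffineMap.lineMap x (x + v) : ℝ →ᵃ[ℝ] X)
    simpa [Function.comp_def, AffineMap.lineMap_apply, add_comm] using this
  have hm := hc'.monotoneOn_deriv fun t _ => (hasDerivAt_line hh x v y t).differentiableAt
  rw [monotoneOn_univ] at hm
  have : deriv (fun t : ℝ => h (x + t • v) y) = fun t : ℝ => inner ℝ (gradX h (x + t • v) y) v :=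
    funext fun t => (hasDerivAt_line hh x v y t).deriv
  rwa [this] at hm

lemma TwiceDiff.inner_hessX_nonneg (hh : TwiceDiff h) {y : Y}
    (hc : ConvexOn ℝ Set.univ (fun x => h x y)) (x v : X) :
    0 ≤ inner ℝ (hessX h x y v) v := by
  have hl : HasDerivAt (fun t : ℝ => x + t • v) v 0 := by
    simpa using ((hasDerivAt_id (0 : ℝ)).smul_const v).const_add x
  have h1 : HasFDerivAt (fun x' => gradX h x' y) (hessX h x y) (x + (0 : ℝ) • v) := by
    simpa using hh.hasFDerivAt_hessX x y
  have h2 := (h1.comp_hasDerivAt (0 : ℝ) hl).inner ℝ (hasDerivAt_const (0 : ℝ) v)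
  have h3 := (monotone_inner_gradX hh.1 hc x v).deriv_nonneg (x := 0)
  have h4 := h2.deriv
  simp only [Function.comp_def, inner_zero_right, zero_add] at h4
  rwa [h4] at h3

/-- The gradient at a minimizer over a subspace is orthogonal to the subspace. -/
lemma inner_gradX_eq_zero_of_isMin (hh : Differentiable ℝ (fun p : X × Y => h p.1 p.2))
    {K : Submodule ℝ X} {x : X} {y : Y} (hx : x ∈ K) (hmin : ∀ z ∈ K, h x y ≤ h z y) {k : X}
    (hk : k ∈ K) : inner ℝ (gradX h x y) k = 0 := by
  have h1 := hasDerivAt_line hh x k y 0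
  rw [zero_smul, add_zero] at h1
  refine IsLocalMin.hasDerivAt_eq_zero (Eventually.of_forall fun t => ?_) h1
  simpa using hmin _ (K.add_mem hx (K.smul_mem t hk))

/-- A coercive operator on a subspace can be inverted in the weak sense. -/
lemma exists_weak_inverse {K : Submodule ℝ X} [CompleteSpace K]
    (H : X →L[ℝ] X) {α : ℝ} (hα : 0 < α) (hH : ∀ k ∈ K, α * ‖k‖ ^ 2 ≤ inner ℝ (H k) k) :
    ∃ R : X →L[ℝ] X, (∀ u, R u ∈ K) ∧ ∀ u, ∀ k ∈ K, inner ℝ (H (R u)) k = inner ℝ u k := by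
  let A : K →L[ℝ] K := K.orthogonalProjectionOnto.comp (H.comp K.subtypeL)
  have hA : ∀ v w : K, inner ℝ (A v) w = inner ℝ (H v) (w : X) := fun v w => by
    simp [A]
  let Bf : K →L[ℝ] K →L[ℝ] ℝ := (innerSL ℝ).comp A
  -- Lax–Milgram for the compression of `H` to `K`; nothing is needed of `H` off `K`.
  have hB : IsCoercive Bf := ⟨α, hα, fun v => by
    have := hH v v.2
    simp only [Bf, ContinuousLinearMap.comp_apply, innerSL_apply_apply, hA]
    rw [mul_assoc, ← sq]
    exact this⟩
  let e := hB.continuousLinearEquivOfBilin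
  refine ⟨K.subtypeL.comp ((e.symm : K →L[ℝ] K).comp K.orthogonalProjectionOnto),
    fun u => by simp, fun u k hk => ?_⟩
  have h1 : inner ℝ (e (e.symm (K.orthogonalProjectionOnto u))) (⟨k, hk⟩ : K)
      = inner ℝ (H (e.symm (K.orthogonalProjectionOnto u))) k := by
    rw [hB.continuousLinearEquivOfBilin_apply]
    exact hA _ ⟨k, hk⟩
  rw [e.apply_symm_apply] at h1
  simp only [ContinuousLinearMap.comp_apply, ContinuousLinearEquiv.coe_coe,
    Submodule.subtypeL_apply]
  rw [← h1]
  simp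

/-- Minimizers over a subspace of a function which is convex in `x` and whose Hessian at one
minimizer is coercive are differentiable there; the derivative solves the linearized equation. -/
theorem exists_hasFDerivAt_minimizer (hh : TwiceDiff h)
    (hc : ∀ y, ConvexOn ℝ Set.univ (fun x => h x y)) (K : Submodule ℝ X) [CompleteSpace K]
    {xs : Y → X} (hK : ∀ y, xs y ∈ K) (hmin : ∀ y, ∀ z ∈ K, h (xs y) y ≤ h z y) (y₀ : Y) {α : ℝ}
    (hα : 0 < α) (hH : ∀ k ∈ K, α * ‖k‖ ^ 2 ≤ inner ℝ (hessX h (xs y₀) y₀ k) k) :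
    ∃ D : Y →L[ℝ] X, HasFDerivAt xs D y₀ ∧ (∀ w, D w ∈ K) ∧ ∀ w, ∀ k ∈ K,
      inner ℝ (hessX h (xs y₀) y₀ (D w)) k
        = -inner ℝ (ContinuousLinearMap.adjoint (jacXY h (xs y₀) y₀) w) k := by
  set x₀ := xs y₀ with hx₀
  set H := hessX h x₀ y₀ with hHdef
  set Jt := ContinuousLinearMap.adjoint (jacXY h x₀ y₀) with hJt
  obtain ⟨R, hRK, hR⟩ := exists_weak_inverse H hα hH
  have hD : ∀ w, ∀ k ∈ K, inner ℝ (H ((-(R.comp Jt)) w)) k = -inner ℝ (Jt w) k := fun w k hk => by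
    simp [hR _ k hk]
  have hDK : ∀ w, (-(R.comp Jt)) w ∈ K := fun w => by simpa using hRK _
  have hrem : ∀ ε : ℝ, 0 < ε → ∃ ρ : ℝ, 0 < ρ ∧ ∀ (a : X) (w : Y) (m : ℝ), ‖a‖ ≤ m → ‖w‖ ≤ m →
      m < ρ → ‖gradX h (x₀ + a) (y₀ + w) - gradX h x₀ y₀ - (H a + Jt w)‖ ≤ ε * m := by
    intro ε hε
    have h1 := (hasFDerivAt_iff_isLittleO.1 (hh.hasFDerivAt_gradX x₀ y₀)).def hε
    obtain ⟨ρ, hρ, h2⟩ := Metric.eventually_nhds_iff.1 h1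
    refine ⟨ρ, hρ, fun a w m ha hw hm => ?_⟩
    have h3 : ‖(a, w)‖ ≤ m := max_le ha hw
    have h4 := h2 (y := (x₀ + a, y₀ + w)) (by
      rw [dist_eq_norm]; simpa using h3.trans_lt hm)
    simp only [Prod.mk_sub_mk, add_sub_cancel_left, add_apply,
      ContinuousLinearMap.comp_apply, ContinuousLinearMap.coe_fst',
      ContinuousLinearMap.coe_snd'] at h4
    exact h4.trans (mul_le_mul_of_nonneg_left h3 hε.le)
  have hz : ∀ y, ∀ k ∈ K, inner ℝ (gradX h (xs y) y) k = 0 := fun y k hk =>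
    inner_gradX_eq_zero_of_isMin hh.1 (hK y) (hmin y) hk
  -- Chosen so that the coercive term αC beats the mixed term ‖Jt‖ plus a remainder αC/2.
  set C : ℝ := 2 * ‖Jt‖ / α + 1 with hC
  have hC1 : 1 ≤ C := by rw [hC]; linarith [show 0 ≤ 2 * ‖Jt‖ / α by positivity]
  have hC0 : 0 < C := by linarith
  have hCα : ‖Jt‖ < α * C - α / 2 * C := by
    have : α * C = 2 * ‖Jt‖ + α := by rw [hC]; field_simp
    linarith
  -- Coercivity is known only at `x₀`, so a displacement δ longer than C‖w‖ is shortened to that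
  -- length. There the expansion makes the slope along δ positive, while monotonicity bounds it by
  -- the slope at the minimizer, which is 0.
  have hlip : ∃ ρ : ℝ, 0 < ρ ∧ ∀ w, ‖w‖ < ρ → ‖xs (y₀ + w) - x₀‖ ≤ C * ‖w‖ := by
    obtain ⟨ρ, hρ, hr⟩ := hrem (α / 2) (by positivity)
    refine ⟨ρ / C, by positivity, fun w hw => ?_⟩
    rw [lt_div_iff₀ hC0, mul_comm] at hw
    by_contra! hcon
    set δ := xs (y₀ + w) - x₀ with hδ
    have hδK : δ ∈ K := K.sub_mem (hK _) (hK _)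
    rcases eq_or_ne w 0 with rfl | hw0
    · simp [hδ, hx₀] at hcon
    have hwpos : 0 < ‖w‖ := norm_pos_iff.2 hw0
    have hδpos : 0 < ‖δ‖ := lt_of_le_of_lt (by positivity) hcon
    set t : ℝ := C * ‖w‖ / ‖δ‖ with ht
    have ht0 : 0 < t := by positivity
    have htδ : t * ‖δ‖ = C * ‖w‖ := by rw [ht]; field_simp
    have ht1 : t ≤ 1 := by rw [ht, div_le_one hδpos]; exact hcon.le
    have hnt : ‖t • δ‖ = C * ‖w‖ := by rw [norm_smul, Real.norm_of_nonneg ht0.le, htδ]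
    have hbound := hr (t • δ) w (C * ‖w‖) hnt.le (le_mul_of_one_le_left hwpos.le hC1) hw
    have hmono := monotone_inner_gradX hh.1 (hc (y₀ + w)) x₀ δ ht1
    simp only [one_smul] at hmono
    rw [show x₀ + δ = xs (y₀ + w) by rw [hδ]; abel, hz _ δ hδK] at hmono
    set r := gradX h (x₀ + t • δ) (y₀ + w) - gradX h x₀ y₀ - (H (t • δ) + Jt w) with hrdef
    have hexp : inner ℝ (gradX h (x₀ + t • δ) (y₀ + w)) δ
        = t * inner ℝ (H δ) δ + inner ℝ (Jt w) δ + inner ℝ r δ := by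
      have : gradX h (x₀ + t • δ) (y₀ + w) = gradX h x₀ y₀ + t • H δ + Jt w + r := by
        rw [hrdef, map_smul]; abel
      rw [this, inner_add_left, inner_add_left, inner_add_left, hz y₀ δ hδK, real_inner_smul_left]
      ring
    have i1 : t * (α * ‖δ‖ ^ 2) ≤ t * inner ℝ (H δ) δ :=
      mul_le_mul_of_nonneg_left (hH δ hδK) ht0.le
    have i2 : -(‖Jt‖ * ‖w‖ * ‖δ‖) ≤ inner ℝ (Jt w) δ := by
      have := (abs_le.1 (abs_real_inner_le_norm (Jt w) δ)).1
      have h2 := mul_le_mul_of_nonneg_right (Jt.le_opNorm w) hδpos.le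
      linarith
    have i3 : -(α / 2 * (C * ‖w‖) * ‖δ‖) ≤ inner ℝ r δ := by
      have := (abs_le.1 (abs_real_inner_le_norm r δ)).1
      have h2 := mul_le_mul_of_nonneg_right hbound hδpos.le
      linarith
    have i4 : t * (α * ‖δ‖ ^ 2) = α * (C * ‖w‖) * ‖δ‖ := by rw [← htδ]; ring
    have i5 : 0 < (α * C - α / 2 * C - ‖Jt‖) * (‖w‖ * ‖δ‖) :=
      mul_pos (by linarith) (by positivity)
    rw [hexp] at hmono
    nlinarith
  obtain ⟨ρ₁, hρ₁, hlip⟩ := hlip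
  refine ⟨-(R.comp Jt), ?_, hDK, hD⟩
  rw [hasFDerivAt_iff_isLittleO_nhds_zero, Asymptotics.isLittleO_iff]
  intro c hc
  -- The remainder is then at most αc‖w‖, and coercivity cancels α.
  obtain ⟨ρ, hρ, hr⟩ := hrem (c * α / C) (by positivity)
  rw [Metric.eventually_nhds_iff]
  refine ⟨min ρ₁ (ρ / C), by positivity, fun w hw => ?_⟩
  rw [dist_zero_right, lt_min_iff, lt_div_iff₀ hC0, mul_comm _ C] at hw
  have hδ := hlip w hw.1
  set δ := xs (y₀ + w) - x₀ with hδdef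
  have hδK : δ ∈ K := K.sub_mem (hK _) (hK _)
  have hbound := hr δ w (C * ‖w‖) hδ (le_mul_of_one_le_left (norm_nonneg w) hC1) hw.2
  set e := δ - (-(R.comp Jt)) w with he
  have heK : e ∈ K := K.sub_mem hδK (hDK w)
  rw [show x₀ + δ = xs (y₀ + w) by rw [hδdef]; abel] at hbound
  set r := gradX h (xs (y₀ + w)) (y₀ + w) - gradX h x₀ y₀ - (H δ + Jt w) with hrdef
  have h1 : inner ℝ (H e) e = -inner ℝ r e := by
    have h2 : inner ℝ r e = -inner ℝ (H δ) e - inner ℝ (Jt w) e := by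
      rw [hrdef, inner_sub_left, inner_sub_left, hz _ e heK, hz y₀ e heK, inner_add_left]
      ring
    rw [h2, show H e = H δ - H ((-(R.comp Jt)) w) by rw [he, map_sub], inner_sub_left,
      hD w e heK]
    ring
  have h2 : α * ‖e‖ ^ 2 ≤ ‖r‖ * ‖e‖ := by
    have := (abs_le.1 (abs_real_inner_le_norm r e)).1
    linarith [hH e heK]
  have h3 : α * ‖e‖ ≤ ‖r‖ := by
    rcases (norm_nonneg e).eq_or_lt with h0 | h0
    · rw [← h0]; simp
    · rw [sq, ← mul_assoc] at h2
      exact le_of_mul_le_mul_right h2 h0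
  have h4 : α * ‖e‖ ≤ α * (c * ‖w‖) := by
    refine (h3.trans hbound).trans_eq ?_
    field_simp
  exact le_of_mul_le_mul_left h4 hα

end Calculus

/-! ## Symmetric operators and inexact Neumann series -/

section Operators

variable {X : Type*} [NormedAddCommGroup X] [InnerProductSpace ℝ X]

/-- Positivity of T at qv - Tv gives 2q‖Tv‖² ≤ q²⟨Tv, v⟩ + ⟨T(Tv), Tv⟩; the form bound at v and at
Tv finishes without spectral theory. -/
lemma norm_apply_le_of_isPositive {T : X →L[ℝ] X} (hT : T.IsPositive) {q : ℝ} (hq : 0 < q)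
    (h : ∀ v, inner ℝ (T v) v ≤ q * ‖v‖ ^ 2) (v : X) : ‖T v‖ ≤ q * ‖v‖ := by
  have h1 : 0 ≤ inner ℝ (T (q • v - T v)) (q • v - T v) := by
    simpa using hT.inner_nonneg_left (q • v - T v)
  have hs : inner ℝ (T (T v)) v = ‖T v‖ ^ 2 := by
    rw [← real_inner_self_eq_norm_sq]; exact hT.isSymmetric (T v) v
  have h2 := h (T v)
  have h3 := h v
  simp only [map_sub, map_smul, inner_sub_left, inner_sub_right, real_inner_smul_left,
    real_inner_smul_right, real_inner_self_eq_norm_sq, hs] at h1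
  have h5 : q * ‖T v‖ ^ 2 ≤ q * (q * ‖v‖) ^ 2 := by
    have h4 := mul_le_mul_of_nonneg_left h3 (mul_nonneg hq.le hq.le)
    linarith
  exact le_of_sq_le_sq (le_of_mul_le_mul_left h5 hq) (by positivity)

lemma sigmaMin_le_norm_apply (A : X →L[ℝ] X) {v : X} (hv : ‖v‖ = 1) : sigmaMin A ≤ ‖A v‖ :=
  ciInf_le (f := fun w : Metric.sphere (0 : X) 1 => ‖A w‖)
    ⟨0, by rintro _ ⟨w, rfl⟩; exact norm_nonneg _⟩ ⟨v, by simpa using hv⟩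

/-- The smallest singular value of a positive operator bounds its quadratic form below. -/
lemma sigmaMin_mul_sq_le [FiniteDimensional ℝ X] {A : X →L[ℝ] X}
    (hs : ∀ v w, inner ℝ (A v) w = inner ℝ v (A w)) (hp : ∀ v, 0 ≤ inner ℝ (A v) v) (v : X) :
    sigmaMin A * ‖v‖ ^ 2 ≤ inner ℝ (A v) v := by
  have hA : (A : X →ₗ[ℝ] X).IsSymmetric := hs
  set b := hA.eigenvectorBasis rfl with hb
  have hAb : ∀ i, A (b i) = hA.eigenvalues rfl i • b i := fun i =>
    hA.apply_eigenvectorBasis rfl i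
  -- Positivity makes each eigenvalue equal to ‖A (b i)‖, a competitor in the infimum.
  have hev : ∀ i, sigmaMin A ≤ hA.eigenvalues rfl i := fun i => by
    have h1 := sigmaMin_le_norm_apply A (b.norm_eq_one i)
    have h2 := hp (b i)
    rw [hAb, real_inner_smul_left, real_inner_self_eq_norm_sq, b.norm_eq_one] at h2
    rw [hAb, norm_smul, b.norm_eq_one, Real.norm_of_nonneg (by linarith)] at h1
    linarith
  have h1 : inner ℝ (A v) v = ∑ i, hA.eigenvalues rfl i * inner ℝ (b i) v ^ 2 := by
    rw [← b.sum_inner_mul_inner]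
    refine Finset.sum_congr rfl fun i _ => ?_
    rw [hs, hAb, real_inner_smul_right, real_inner_comm v]
    ring
  rw [h1, ← b.sum_sq_norm_inner_right v, Finset.mul_sum]
  refine Finset.sum_le_sum fun i _ => ?_
  rw [Real.norm_eq_abs, sq_abs]
  exact mul_le_mul_of_nonneg_right (hev i) (sq_nonneg _)

/-- The Neumann iteration `u ↦ (1 - ηH) P u` for the solution of a coercive equation on `K`, with
the projection `P` onto `K` replaced by an approximation `Pt`. -/
theorem norm_sum_sub_le_of_inexact_projection {K : Submodule ℝ X} [K.HasOrthogonalProjection]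
    {H : X →L[ℝ] X} {η α ε : ℝ} (hηα : 0 < η * α) (hq0 : 0 ≤ 1 - η * α)
    (hT : ∀ v, ‖v - η • H v‖ ≤ (1 - η * α) * ‖v‖) {Pt : X →ₗ[ℝ] X} (hε : 0 ≤ ε)
    (hPt : ∀ v, ‖Pt v - K.starProjection v‖ ≤ ε * ‖v‖)
    (hq : (1 - η * α) * (1 + ε) ≤ 1 - η * α / 2)
    {U : ℕ → X} (hU : ∀ m, U (m + 1) = Pt (U m) - η • H (Pt (U m)))
    {s : X} (hsK : s ∈ K) (hs : ∀ k ∈ K, η * inner ℝ (H s) k = inner ℝ (U 0) k) (M : ℕ) :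
    ‖∑ m ∈ Finset.range M, Pt (U m) - s‖
      ≤ (2 * ε / (η * α) ^ 2 + (1 - η * α) ^ M / (η * α)) * ‖U 0‖ := by
  set q := 1 - η * α with hqdef
  set P := K.starProjection with hP
  set N := ‖U 0‖ with hN
  let T : X →L[ℝ] X := ContinuousLinearMap.id ℝ X - η • H
  have hTn : ∀ v, ‖T v‖ ≤ q * ‖v‖ := hT
  have hPn : ∀ v, ‖P v‖ ≤ ‖v‖ := fun v => K.norm_starProjection_apply_le v
  -- The exact iteration, to which the inexact `U` is compared.
  let W : ℕ → X := fun m => (fun v => T (P v))^[m] (U 0)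
  have hW : ∀ m, W (m + 1) = T (P (W m)) := fun m => Function.iterate_succ_apply' _ _ _
  have hTP : ∀ v, ‖T (P v)‖ ≤ q * ‖v‖ := fun v =>
    (hTn _).trans (mul_le_mul_of_nonneg_left (hPn v) hq0)
  have hWn : ∀ m, ‖W m‖ ≤ q ^ m * N := fun m => by
    induction m with
    | zero => simp [W, hN]
    | succ m ih =>
      rw [hW, pow_succ', mul_assoc]
      exact (hTP _).trans (mul_le_mul_of_nonneg_left ih hq0)
  have hPtn : ∀ v, ‖Pt v‖ ≤ (1 + ε) * ‖v‖ := fun v => by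
    have := norm_add_le (P v) (Pt v - P v)
    rw [add_sub_cancel] at this
    linarith [hPn v, hPt v]
  set e : ℕ → ℝ := fun m => ‖Pt (U m) - P (W m)‖ with he
  have he0 : e 0 ≤ ε * N := hPt (U 0)
  -- The old discrepancy passes through `T` and `Pt`; the new error of `Pt` acts on the exact
  -- iterate, which decays geometrically.
  have hes : ∀ m, e (m + 1) ≤ q * (1 + ε) * e m + ε * N * q ^ (m + 1) := by
    intro m
    have h1 : Pt (U (m + 1)) - P (W (m + 1))
        = Pt (U (m + 1) - W (m + 1)) + (Pt (W (m + 1)) - P (W (m + 1))) := by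
      rw [map_sub]; abel
    have h2 : U (m + 1) - W (m + 1) = T (Pt (U m) - P (W m)) := by
      rw [map_sub, ← hW, hU]; rfl
    have h3 : ‖U (m + 1) - W (m + 1)‖ ≤ q * e m := h2 ▸ hTn _
    have h4 : e (m + 1) ≤ (1 + ε) * ‖U (m + 1) - W (m + 1)‖ + ε * ‖W (m + 1)‖ := by
      simp only [he, h1]
      exact (norm_add_le _ _).trans (add_le_add (hPtn _) (hPt _))
    have h5 := mul_le_mul_of_nonneg_left h3 (by linarith : 0 ≤ 1 + ε)
    have h6 := mul_le_mul_of_nonneg_left (hWn (m + 1)) hε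
    linarith
  have hgeom : ∀ m, η * α * ∑ i ∈ Finset.range m, q ^ i ≤ 1 := fun m => by
    have := mul_neg_geom_sum q m
    rw [show 1 - q = η * α by rw [hqdef]; ring] at this
    rw [this]
    linarith [pow_nonneg hq0 m]
  have hE : ∀ m, ∑ i ∈ Finset.range m, e i ≤ 2 * ε / (η * α) ^ 2 * N := by
    intro m
    induction m with
    | zero => simp; positivity
    | succ m ih =>
      have h1 : ∑ i ∈ Finset.range (m + 1), e i
          ≤ q * (1 + ε) * ∑ i ∈ Finset.range m, e i
            + ε * N * ∑ i ∈ Finset.range (m + 1), q ^ i := by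
        rw [Finset.sum_range_succ', Finset.sum_range_succ' (fun i => q ^ i), Finset.mul_sum,
          mul_add (ε * N), Finset.mul_sum, ← add_assoc, ← Finset.sum_add_distrib, pow_zero, mul_one]
        exact add_le_add (Finset.sum_le_sum fun i _ => hes i) he0
      have h2 : ∑ i ∈ Finset.range (m + 1), q ^ i ≤ 1 / (η * α) := by
        rw [le_div_iff₀ hηα, mul_comm]; exact hgeom _
      have h3 : ε * N * ∑ i ∈ Finset.range (m + 1), q ^ i ≤ ε * N * (1 / (η * α)) :=
        mul_le_mul_of_nonneg_left h2 (by positivity)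
      have h4 : q * (1 + ε) * ∑ i ∈ Finset.range m, e i
          ≤ (1 - η * α / 2) * (2 * ε / (η * α) ^ 2 * N) :=
        mul_le_mul hq ih (Finset.sum_nonneg fun _ _ => norm_nonneg _)
          ((mul_nonneg hq0 (by linarith)).trans hq)
      -- The claimed bound is the fixed point of x ↦ (1 - z/2) x + εN/z with z = ηα.
      have h5 : (1 - η * α / 2) * (2 * ε / (η * α) ^ 2 * N) + ε * N * (1 / (η * α))
          = 2 * ε / (η * α) ^ 2 * N := by
        generalize η * α = z at *
        field_simp
        ring
      linarith
  have hPs : P s = s := K.starProjection_eq_self_iff.2 hsK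
  -- The equation for `s` says that U 0 - ηHs is orthogonal to `K`. Hence each further term of the
  -- series applies P T to the error of the partial sum.
  have hfix : s = P (U 0) + P (T s) := by
    have h1 : P (U 0) = P (η • H s) := by
      rw [hP, ← sub_eq_zero, ← map_sub, K.starProjection_apply_eq_zero_iff,
        Submodule.mem_orthogonal']
      intro k hk
      rw [inner_sub_left, real_inner_smul_left, hs k hk, sub_self]
    rw [h1, ← map_add]
    simp [T, hPs]
  have hBn : ∀ v, ‖P (T v)‖ ≤ q * ‖v‖ := fun v => (hPn _).trans (hTn v)
  have hsn : ‖s‖ ≤ N / (η * α) := by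
    rw [le_div_iff₀ hηα]
    have h1 := norm_add_le (P (U 0)) (P (T s))
    rw [← hfix] at h1
    have h2 := hPn (U 0)
    have h3 := hBn s
    rw [hqdef] at h3
    linarith
  have hsM : ∀ m, ‖∑ i ∈ Finset.range m, P (W i) - s‖ ≤ q ^ m * ‖s‖ := by
    intro m
    induction m with
    | zero => simp
    | succ m ih =>
      have h1 : ∑ i ∈ Finset.range (m + 1), P (W i) - s
          = P (T (∑ i ∈ Finset.range m, P (W i) - s)) := by
        rw [Finset.sum_range_succ', map_sub, map_sub, map_sum, map_sum]
        simp only [hW]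
        nth_rewrite 1 [hfix]
        simp only [W, Function.iterate_zero, id]
        abel
      rw [h1, pow_succ', mul_assoc]
      exact (hBn _).trans (mul_le_mul_of_nonneg_left ih hq0)
  have hsplit : ∑ m ∈ Finset.range M, Pt (U m) - s
      = ∑ m ∈ Finset.range M, (Pt (U m) - P (W m)) + (∑ m ∈ Finset.range M, P (W m) - s) := by
    rw [Finset.sum_sub_distrib]; abel
  rw [hsplit, add_mul]
  refine (norm_add_le _ _).trans (add_le_add ((norm_sum_le _ _).trans (hE M)) ?_)
  refine (hsM M).trans ((mul_le_mul_of_nonneg_left hsn (pow_nonneg hq0 M)).trans_eq ?_)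
  ring

end Operators

/-! ## Separable functions of block vectors -/

lemma apply_eq_of_hasFDerivAt {E F : Type*} [NormedAddCommGroup E] [NormedSpace ℝ E]
    [NormedAddCommGroup F] [NormedSpace ℝ F] {f : E → F} {f₁ f₂ : E →L[ℝ] F} {x : E}
    (h₁ : HasFDerivAt f f₁ x) (h₂ : HasFDerivAt f f₂ x) (v : E) : f₁ v = f₂ v := by
  rw [h₁.unique h₂]

section Blocks

variable {n d e : ℕ}

/-- The separable function `(x, y) ↦ ∑ i, h i (x i) (y i)` of block vectors. -/
def blockSum (h : Fin n → Vec d → Vec e → ℝ) (x : BlockVec n d) (y : BlockVec n e) : ℝ :=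
  ∑ i, h i (x i) (y i)

/-- The projection of a block vector to its block `i`. -/
def blockProj (i : Fin n) : BlockVec n d →L[ℝ] Vec d := PiLp.proj 2 (fun _ : Fin n => Vec d) i

@[simp] lemma blockProj_apply (i : Fin n) (x : BlockVec n d) : blockProj i x = x i := rfl

lemma hasFDerivAt_block {E : Type*} [NormedAddCommGroup E] [NormedSpace ℝ E]
    {f : E → BlockVec n d} {f' : E →L[ℝ] BlockVec n d} {x : E} (hf : HasFDerivAt f f' x)
    (i : Fin n) : HasFDerivAt (fun x => f x i) ((blockProj i).comp f') x :=
  HasFDerivAt.comp (g := blockProj i) x (blockProj i).hasFDerivAt hf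

lemma hasFDerivAt_comp_block {E : Type*} [NormedAddCommGroup E] [NormedSpace ℝ E]
    {g : Vec d → E} {g' : Vec d →L[ℝ] E} {x : BlockVec n d} {i : Fin n}
    (hg : HasFDerivAt g g' (x i)) : HasFDerivAt (fun x => g (x i)) (g'.comp (blockProj i)) x :=
  HasFDerivAt.comp (f := blockProj i) x hg (blockProj i).hasFDerivAt

variable {h : Fin n → Vec d → Vec e → ℝ}

lemma differentiable_blockPair (i : Fin n) :
    Differentiable ℝ (fun p : BlockVec n d × BlockVec n e => (p.1 i, p.2 i)) :=
  ((blockProj i).differentiable.comp differentiable_fst).prodMk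
    ((blockProj i).differentiable.comp differentiable_snd)

lemma differentiable_blockSum (hd : ∀ i, Differentiable ℝ (fun p : Vec d × Vec e => h i p.1 p.2)) :
    Differentiable ℝ (fun p : BlockVec n d × BlockVec n e => blockSum h p.1 p.2) := by
  unfold blockSum
  exact Differentiable.fun_sum fun i _ => (hd i).comp (differentiable_blockPair i)

lemma gradX_blockSum (hd : ∀ i, Differentiable ℝ (fun p : Vec d × Vec e => h i p.1 p.2))
    (x : BlockVec n d) (y : BlockVec n e) :
    gradX (blockSum h) x y = WithLp.toLp 2 (fun i => gradX (h i) (x i) (y i)) := by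
  refine HasGradientAt.gradient ?_
  rw [hasGradientAt_iff_hasFDerivAt]
  refine (HasFDerivAt.fun_sum (u := Finset.univ) fun i _ => hasFDerivAt_comp_block
    (hasGradientAt_gradX (hd i) (x i) (y i)).hasFDerivAt).congr_fderiv ?_
  refine ContinuousLinearMap.ext fun v => ?_
  simp [PiLp.inner_apply]

lemma gradX_blockSum_apply
    (hd : ∀ i, Differentiable ℝ (fun p : Vec d × Vec e => h i p.1 p.2))
    (x : BlockVec n d) (y : BlockVec n e) (i : Fin n) :
    gradX (blockSum h) x y i = gradX (h i) (x i) (y i) := by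
  rw [gradX_blockSum hd]

lemma gradY_blockSum (hd : ∀ i, Differentiable ℝ (fun p : Vec d × Vec e => h i p.1 p.2))
    (x : BlockVec n d) (y : BlockVec n e) :
    gradY (blockSum h) x y = WithLp.toLp 2 (fun i => gradY (h i) (x i) (y i)) :=
  gradX_blockSum (h := fun i b a => h i a b)
    (fun i => (hd i).comp (f := fun p : Vec e × Vec d => (p.2, p.1)) (by fun_prop)) y x

lemma twiceDiff_blockSum (hd : ∀ i, TwiceDiff (h i)) : TwiceDiff (blockSum h) := by
  refine ⟨differentiable_blockSum fun i => (hd i).1, ?_⟩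
  simp only [gradX_blockSum fun i => (hd i).1]
  rw [differentiable_piLp]
  exact fun i => (hd i).2.comp (differentiable_blockPair i)

lemma hessX_blockSum (hd : ∀ i, TwiceDiff (h i)) (x : BlockVec n d) (y : BlockVec n e)
    (v : BlockVec n d) :
    hessX (blockSum h) x y v = WithLp.toLp 2 (fun i => hessX (h i) (x i) (y i) (v i)) := by
  ext1 i
  have h1 := hasFDerivAt_block ((twiceDiff_blockSum hd).hasFDerivAt_hessX x y) i
  rw [funext fun x' => gradX_blockSum_apply (fun i => (hd i).1) x' y i] at h1
  have h2 := hasFDerivAt_comp_block (i := i) ((hd i).hasFDerivAt_hessX (x i) (y i))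
  exact apply_eq_of_hasFDerivAt h1 h2 v

lemma jacXY_blockSum (hd : ∀ i, TwiceDiff (h i)) (x : BlockVec n d) (y : BlockVec n e)
    (v : BlockVec n d) :
    jacXY (blockSum h) x y v = WithLp.toLp 2 (fun i => jacXY (h i) (x i) (y i) (v i)) := by
  -- The transpose is the actual Fréchet derivative, so the block formula is read off there and then
  -- dualized.
  have key : ∀ w i, (ContinuousLinearMap.adjoint (jacXY (blockSum h) x y) w) i
      = ContinuousLinearMap.adjoint (jacXY (h i) (x i) (y i)) (w i) := fun w i => by
    have h1 := hasFDerivAt_block ((twiceDiff_blockSum hd).hasFDerivAt_adjoint_jacXY x y) i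
    rw [funext fun y' => gradX_blockSum_apply (fun i => (hd i).1) x y' i] at h1
    have h2 := hasFDerivAt_comp_block (i := i) ((hd i).hasFDerivAt_adjoint_jacXY (x i) (y i))
    exact apply_eq_of_hasFDerivAt h1 h2 w
  refine ext_inner_right ℝ fun w => ?_
  rw [← ContinuousLinearMap.adjoint_inner_right, PiLp.inner_apply, PiLp.inner_apply]
  refine Finset.sum_congr rfl fun i _ => ?_
  rw [key, ContinuousLinearMap.adjoint_inner_right]

lemma convexOn_blockSum {y : BlockVec n e}
    (hc : ∀ i, ConvexOn ℝ Set.univ (fun a => h i a (y i))) :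
    ConvexOn ℝ Set.univ (fun x => blockSum h x y) := by
  refine ⟨convex_univ, fun a _ b _ s t hs ht hst => ?_⟩
  simp only [blockSum, smul_eq_mul, Finset.mul_sum]
  rw [← Finset.sum_add_distrib]
  exact Finset.sum_le_sum fun i _ => by
    simpa using (hc i).2 (Set.mem_univ (a i)) (Set.mem_univ (b i)) hs ht hst

/-- The subspace of block vectors all of whose blocks agree. -/
def consensus (n d : ℕ) : Submodule ℝ (BlockVec n d) where
  carrier := {x | ∀ i j, x i = x j}
  add_mem' := fun {a b} ha hb i j => by simp [ha i j, hb i j]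
  zero_mem' := fun i j => by simp
  smul_mem' := fun c a ha i j => by simp [ha i j]

lemma starProjection_consensus (u : BlockVec n d) (i : Fin n) :
    (consensus n d).starProjection u i = (n : ℝ)⁻¹ • ∑ j, u j := by
  have hn : (n : ℝ) ≠ 0 := by exact_mod_cast i.pos.ne'
  have hmem : (WithLp.toLp 2 fun _ => (n : ℝ)⁻¹ • ∑ j, u j : BlockVec n d) ∈ consensus n d :=
    fun _ _ => rfl
  rw [Submodule.eq_starProjection_of_mem_of_inner_eq_zero hmem]
  intro w hw
  rw [PiLp.inner_apply]
  have : ∀ j, w j = w i := fun j => hw j i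
  simp only [this, ← sum_inner]
  simp [Finset.sum_sub_distrib, ← Nat.cast_smul_eq_nsmul ℝ, smul_smul, hn]

/-- `S` steps of Push-Sum as a linear map on block vectors. -/
def pushSumMap (G : ℕ → Digraph (Fin n)) (S d : ℕ) : BlockVec n d →ₗ[ℝ] BlockVec n d where
  toFun u := WithLp.toLp 2 (pushSum G S u)
  map_add' u v := by
    ext1 i
    simp [pushSum_eq_sum, Finset.sum_add_distrib]
  map_smul' c u := by
    ext1 i
    simp [pushSum_eq_sum, Finset.smul_sum, smul_comm c]

/-- An entrywise error ε costs n in operator norm: √n from Cauchy–Schwarz in each block and √n from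
the n blocks. -/
lemma norm_pushSumMap_sub_le {G : ℕ → Digraph (Fin n)} {S : ℕ} {ε : ℝ} (hε : 0 ≤ ε)
    (h : ∀ i j, |pushMatrix G S i j - (n : ℝ)⁻¹| ≤ ε) (u : BlockVec n d) :
    ‖pushSumMap G S d u - (consensus n d).starProjection u‖ ≤ n * ε * ‖u‖ := by
  have h1 : ∀ i, ‖(pushSumMap G S d u - (consensus n d).starProjection u) i‖
      ≤ ε * ∑ j, ‖u j‖ := by
    intro i
    have : (pushSumMap G S d u - (consensus n d).starProjection u) i
        = ∑ j, (pushMatrix G S i j - (n : ℝ)⁻¹) • u j := by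
      simp only [PiLp.sub_apply, starProjection_consensus, sub_smul, Finset.sum_sub_distrib,
        Finset.smul_sum]
      rw [← pushSum_eq_sum]
      rfl
    rw [this, Finset.mul_sum]
    refine (norm_sum_le _ _).trans (Finset.sum_le_sum fun j _ => ?_)
    rw [norm_smul, Real.norm_eq_abs]
    exact mul_le_mul_of_nonneg_right (h i j) (norm_nonneg _)
  refine le_of_sq_le_sq ?_ (by positivity)
  rw [PiLp.norm_sq_eq_of_L2]
  have h2 : (∑ j, ‖u j‖) ^ 2 ≤ n * ‖u‖ ^ 2 := by
    rw [PiLp.norm_sq_eq_of_L2]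
    simpa using sq_sum_le_card_mul_sum_sq (s := Finset.univ) (f := fun j => ‖u j‖)
  calc _ ≤ ∑ _i : Fin n, (ε * ∑ j, ‖u j‖) ^ 2 :=
        Finset.sum_le_sum fun i _ => pow_le_pow_left₀ (norm_nonneg _) (h1 i) 2
    _ = n * ε ^ 2 * (∑ j, ‖u j‖) ^ 2 := by simp; ring
    _ ≤ n * ε ^ 2 * (n * ‖u‖ ^ 2) := mul_le_mul_of_nonneg_left h2 (by positivity)
    _ = _ := by ring

end Blocks

/-! ### Expectations of operators -/

section Expectation

variable {Ω X E : Type*} [MeasurableSpace Ω] {μ : Measure Ω} [IsProbabilityMeasure μ]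

/-- B ↦ ⟨Bv, v⟩ is a continuous linear functional, so it commutes with the integral. -/
lemma mul_sq_le_inner_integral [NormedAddCommGroup X] [InnerProductSpace ℝ X] [CompleteSpace X]
    {A : Ω → X →L[ℝ] X} (hA : Integrable A μ) {α : ℝ} (v : X)
    (h : ∀ ω, α * ‖v‖ ^ 2 ≤ inner ℝ (A ω v) v) :
    α * ‖v‖ ^ 2 ≤ inner ℝ ((∫ ω, A ω ∂μ) v) v := by
  let L : (X →L[ℝ] X) →L[ℝ] ℝ := (innerSL ℝ v).comp (ContinuousLinearMap.apply ℝ _ v)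
  have hL : ∀ B, L B = inner ℝ (B v) v := fun B => by
    simp [L, real_inner_comm]
  have h1 : ∫ _ω, α * ‖v‖ ^ 2 ∂μ = α * ‖v‖ ^ 2 := by simp
  rw [← hL, ← L.integral_comp_comm hA, ← h1]
  refine integral_mono (integrable_const _) (L.integrable_comp hA) fun ω => ?_
  simpa only [hL] using h ω

lemma norm_integral_le_of_forall_norm_le [NormedAddCommGroup E] [NormedSpace ℝ E] {A : Ω → E}
    {β : ℝ} (h : ∀ ω, ‖A ω‖ ≤ β) : ‖∫ ω, A ω ∂μ‖ ≤ β := by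
  simpa using norm_integral_le_of_norm_le_const (μ := μ) (Filter.Eventually.of_forall h)

end Expectation

/-! ### The bilevel problem and HGP in block form -/

namespace Problem

variable {n dx dl : ℕ} {Q : Problem.{u} n dx dl}

lemma inner_eq_blockSum : Q.inner = blockSum Q.meanCost := rfl

lemma StronglyConvex.convexOn (hQ : Q.StronglyConvex) (i : Fin n) (b : Vec dl) (ξ : Q.Inst i) :
    ConvexOn ℝ Set.univ (fun a => Q.g i a b ξ) := by
  obtain ⟨m, hm, h⟩ := hQ i b ξ
  rw [← strongConvexOn_zero]
  exact h.mono hm.le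

/-- The moduli of strong convexity may depend on the instance, so only convexity is carried through
the expectation; coercivity comes from α in `mul_sq_le_inner_hessX`. -/
lemma StronglyConvex.convexOn_inner (hQ : Q.StronglyConvex) (hR : Q.Regular)
    (l : BlockVec n dl) : ConvexOn ℝ Set.univ (fun x => Q.inner x l) := by
  refine convexOn_blockSum fun i => ⟨convex_univ, fun a _ b _ s t hs ht hst => ?_⟩
  have hint := fun a => hR.2.2.1 i a (l i)
  simp only [meanCost, smul_eq_mul]
  rw [← integral_const_mul, ← integral_const_mul,
    ← integral_add ((hint a).const_mul s) ((hint b).const_mul t)]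
  exact integral_mono (hint _) (((hint a).const_mul s).add ((hint b).const_mul t)) fun ξ =>
    (hQ.convexOn i (l i) (ξ i)).2 (Set.mem_univ a) (Set.mem_univ b) hs ht hst

lemma Regular.twiceDiff_sampled (hR : Q.Regular) (ξ : ∀ i, Q.Inst i) : TwiceDiff (Q.sampled ξ) :=
  twiceDiff_blockSum fun i => hR.2.1 i (ξ i)

lemma Regular.twiceDiff_inner (hR : Q.Regular) : TwiceDiff Q.inner :=
  twiceDiff_blockSum hR.2.2.2

lemma Regular.differentiable_outer (hR : Q.Regular) :
    Differentiable ℝ (fun p : BlockVec n dx × BlockVec n dl => Q.outer p.1 p.2) :=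
  differentiable_blockSum hR.1

/-- A lower bound on the singular values of all sampled Hessians makes the mean Hessian coercive. -/
lemma mul_sq_le_inner_hessX (hR : Q.Regular) (hQ : Q.StronglyConvex) (hU : Q.Unbiased)
    {x : BlockVec n dx} {l : BlockVec n dl} {α : ℝ}
    (hα : ∀ ξ, α ≤ sigmaMin (hessX (Q.sampled ξ) x l)) (v : BlockVec n dx) :
    α * ‖v‖ ^ 2 ≤ Inner.inner ℝ (hessX Q.inner x l v) v := by
  obtain ⟨hint, heq⟩ := (hU x l).1
  rw [← heq]
  refine mul_sq_le_inner_integral hint v fun ξ => ?_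
  have hs := hR.twiceDiff_sampled ξ
  have hc : ConvexOn ℝ Set.univ (fun x => Q.sampled ξ x l) :=
    convexOn_blockSum (h := fun i a b => Q.g i a b (ξ i)) fun i => hQ.convexOn i (l i) (ξ i)
  exact (mul_le_mul_of_nonneg_right (hα ξ) (sq_nonneg _)).trans
    (sigmaMin_mul_sq_le (hs.inner_hessX_comm x l) (hs.inner_hessX_nonneg hc x) v)

lemma norm_jacXY_inner_le (hU : Q.Unbiased) {x : BlockVec n dx} {l : BlockVec n dl} {β : ℝ}
    (hβ : ∀ ξ, ‖jacXY (Q.sampled ξ) x l‖ ≤ β) : ‖jacXY Q.inner x l‖ ≤ β := by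
  rw [← (hU x l).2.2]
  exact norm_integral_le_of_forall_norm_le hβ

/-- The primal iterates of exact Hyper-Gradient Push as block vectors. -/
def primal (Q : Problem.{u} n dx dl) (G : ℕ → Digraph (Fin n)) (η : ℝ) (S : ℕ)
    (x : BlockVec n dx) (l : BlockVec n dl) (m : ℕ) : BlockVec n dx :=
  WithLp.toLp 2 (Q.exactHGP G η S x l m).1

variable {G : ℕ → Digraph (Fin n)} {η : ℝ} {S : ℕ} {x : BlockVec n dx} {l : BlockVec n dl}

lemma primal_zero (hR : Q.Regular) : Q.primal G η S x l 0 = gradX Q.outer x l :=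
  (gradX_blockSum hR.1 x l).symm

lemma primal_succ (hR : Q.Regular) (m : ℕ) :
    Q.primal G η S x l (m + 1) = pushSumMap G S dx (Q.primal G η S x l m)
      - η • hessX Q.inner x l (pushSumMap G S dx (Q.primal G η S x l m)) := by
  rw [inner_eq_blockSum, hessX_blockSum hR.2.2.2]
  rfl

lemma estimate_eq (hR : Q.Regular) (M : ℕ) :
    Q.estimate G η S M x l = gradY Q.outer x l - η • jacXY Q.inner x l
      (∑ m ∈ Finset.range M, pushSumMap G S dx (Q.primal G η S x l m)) := by
  induction M with
  | zero =>
    simp only [Finset.range_zero, Finset.sum_empty, map_zero, smul_zero, sub_zero]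
    exact (gradY_blockSum hR.1 x l).symm
  | succ M ih =>
    have h1 : Q.estimate G η S (M + 1) x l = Q.estimate G η S M x l
        - η • jacXY Q.inner x l (pushSumMap G S dx (Q.primal G η S x l M)) := by
      rw [inner_eq_blockSum, jacXY_blockSum hR.2.2.2]
      rfl
    rw [h1, ih, Finset.sum_range_succ, map_add, smul_add]
    abel

/-- Implicit differentiation of the outer cost: the hyper-gradient is `∂_l f - η J s` for the
solution `s` of the adjoint equation `η P H s = P ∂ₓ f` in the consensus subspace. -/
theorem exists_hasGradientAt_outer (hR : Q.Regular) (hQ : Q.StronglyConvex)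
    {xs : BlockVec n dl → BlockVec n dx} (hxs : ∀ l, Q.IsSolution (xs l) l) {α : ℝ} (hα : 0 < α)
    (hη : η ≠ 0) (l : BlockVec n dl)
    (hH : ∀ v, α * ‖v‖ ^ 2 ≤ Inner.inner ℝ (hessX Q.inner (xs l) l v) v) :
    ∃ s ∈ consensus n dx, (∀ k ∈ consensus n dx,
      η * Inner.inner ℝ (hessX Q.inner (xs l) l s) k
        = Inner.inner ℝ (gradX Q.outer (xs l) l) k) ∧
      HasGradientAt (fun l' => Q.outer (xs l') l')
        (gradY Q.outer (xs l) l - η • jacXY Q.inner (xs l) l s) l := by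
  obtain ⟨D, hD, hDK, hDeq⟩ := exists_hasFDerivAt_minimizer hR.twiceDiff_inner
    (hQ.convexOn_inner hR) (consensus n dx) (fun l => (hxs l).1) (fun l => (hxs l).2) l hα
    (fun k _ => hH k)
  obtain ⟨R, hRK, hReq⟩ := exists_weak_inverse (K := consensus n dx)
    (hessX Q.inner (xs l) l) hα (fun k _ => hH k)
  set u := gradX Q.outer (xs l) l with hu
  have hs : ∀ k ∈ consensus n dx,
      η * Inner.inner ℝ (hessX Q.inner (xs l) l (η⁻¹ • R u)) k = Inner.inner ℝ u k := by
    intro k hk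
    rw [map_smul, real_inner_smul_left, hReq u k hk, mul_inv_cancel_left₀ hη]
  have hsK : η⁻¹ • R u ∈ consensus n dx := Submodule.smul_mem _ _ (hRK u)
  refine ⟨η⁻¹ • R u, hsK, hs, ?_⟩
  generalize η⁻¹ • R u = s at hs hsK
  rw [hasGradientAt_iff_hasFDerivAt]
  have h1 := (hR.differentiable_outer (xs l, l)).hasFDerivAt.comp l
    (f := fun l' => (xs l', l')) (hD.prodMk (hasFDerivAt_id l))
  refine HasFDerivAt.congr_fderiv (f' := _) h1 ?_
  refine ContinuousLinearMap.ext fun w => ?_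
  symm
  simp only [InnerProductSpace.toDual_apply_apply, ContinuousLinearMap.comp_apply,
    ContinuousLinearMap.prod_apply, ContinuousLinearMap.id_apply,
    fderiv_apply_eq_inner hR.differentiable_outer, ← hu]
  -- The adjoint trick: ⟨∂ₓf, Dw⟩ = η⟨Hs, Dw⟩ = η⟨s, H Dw⟩ = -η⟨Jᵀw, s⟩ = -η⟨w, Js⟩, testing each
  -- equation with the solution of the other.
  rw [← hs _ (hDK w), hR.twiceDiff_inner.inner_hessX_comm, real_inner_comm _ s, hDeq w s hsK,
    ContinuousLinearMap.adjoint_inner_left, inner_sub_left, real_inner_smul_left,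
    real_inner_comm _ w]
  ring

end Problem

/-! ### Choice of constants and conclusion -/

lemma pow_le_of_log_div_log_le {τ z : ℝ} {S : ℕ} (hτ0 : 0 < τ) (hτ1 : τ < 1) (hz : 0 < z)
    (h : Real.log z / Real.log τ ≤ S) : τ ^ S ≤ z := by
  rw [div_le_iff_of_neg (Real.log_neg hτ0 hτ1), ← Real.log_pow] at h
  exact (Real.log_le_log_iff (by positivity) hz).1 h

end HGP
end

theorem mainTheorem3
    -- the time-varying directed network
    (n B : ℕ) (hB : 0 < B) (G : ℕ → Digraph (Fin n)) (hG : HGP.RepeatedlyConnected G B) :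
    -- `τ` and `δ` depend on the network only
    ∃ τ δ : ℝ, 0 < τ ∧ τ < 1 ∧ 0 < δ ∧
    ∀ η α β : ℝ, 0 < η → 0 < α → α < 1 / η →
    -- the constants of the term `exp (-O(M))` depend on `η`, `α`, `β` only
    ∃ C c : ℝ, 0 ≤ C ∧ 0 < c ∧
    ∀ (dx dl : ℕ) (Q : HGP.Problem.{u} n dx dl)
      (xs : HGP.BlockVec n dl → HGP.BlockVec n dx),
      Q.Regular → Q.StronglyConvex → Q.Unbiased → Q.BoundedNoise →
      -- `xs l` is the solution `x(l)` of the inner problem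
      (∀ l, Q.IsSolution (xs l) l) →
      IsGLB {r : ℝ | ∃ l ξ, r = HGP.sigmaMin (HGP.hessX (Q.sampled ξ) (xs l) l)} α →
      IsLUB {r : ℝ | ∃ l ξ, r = ‖HGP.jacXY (Q.sampled ξ) (xs l) l‖} β →
    ∀ l : HGP.BlockVec n dl,
      -- the Jacobian `I - η ∂ₓ² g` of the fixed-point map is positive semidefinite
      (ContinuousLinearMap.id ℝ (HGP.BlockVec n dx)
        - η • HGP.hessX Q.inner (xs l) l).IsPositive →
      DifferentiableAt ℝ (fun l' => Q.outer (xs l') l') l ∧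
      ∀ S : ℕ,
        (S : ℝ) ≥ Real.log (δ / (16 * √(n : ℝ)) * (η * α / (1 - η * α))) / Real.log τ →
        ∀ M : ℕ,
          ‖Q.estimate G η S M (xs l) l - Q.hyperGrad xs l‖ ≤
            (2 * β / (η * α ^ 2) * (8 * √(n : ℝ) / δ) * τ ^ S + C * Real.exp (-(c * M)))
              * ‖HGP.gradX Q.outer (xs l) l‖ := by
  -- Without clients all block spaces are trivial, and arbitrary constants serve.
  rcases Nat.eq_zero_or_pos n with rfl | hn
  · refine ⟨1 / 2, 1, by norm_num, by norm_num, one_pos, fun η α β _ _ _ => ⟨0, 1, le_rfl, one_pos,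
      fun dx dl Q xs _ _ _ _ _ _ _ l _ => ⟨?_, fun S _ M => ?_⟩⟩⟩
    · exact (hasFDerivAt_of_subsingleton (𝕜 := ℝ) (fun l' => Q.outer (xs l') l') l).differentiableAt
    · rw [Subsingleton.elim (HGP.gradX Q.outer (xs l) l) 0,
        Subsingleton.elim (Q.estimate G η S M (xs l) l - Q.hyperGrad xs l) 0]
      simp
  obtain ⟨A, τ, hA, hτ0, hτ1, hW⟩ := HGP.exists_pushMatrix_sub_le hn hB hG
  have hn' : (0 : ℝ) < n := by exact_mod_cast hn
  have hsn : 0 < √(n : ℝ) := Real.sqrt_pos.2 hn'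
  -- This δ makes 8√n/δ equal to nA, the constant of the operator norm error nAτ^S of Push-Sum.
  refine ⟨τ, 8 * √(n : ℝ) / (n * A), hτ0, hτ1, by positivity, fun η α β hη hα hαη => ?_⟩
  have hηα : 0 < η * α := mul_pos hη hα
  have hηα1 : η * α < 1 := by rw [lt_div_iff₀ hη] at hαη; linarith
  have hq : 0 < 1 - η * α := by linarith
  -- The truncation error is ηβ(1 - ηα)^M/(ηα). The absolute value is there because β ≥ 0 is known
  -- only once a problem is given.
  refine ⟨|β| / α, -Real.log (1 - η * α), by positivity,
    neg_pos.2 (Real.log_neg hq (by linarith)), ?_⟩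
  intro dx dl Q xs hR hQ hU _ hxs hαQ hβQ l hpos
  have hH : ∀ v, α * ‖v‖ ^ 2 ≤ inner ℝ (HGP.hessX Q.inner (xs l) l v) v :=
    HGP.Problem.mul_sq_le_inner_hessX hR hQ hU fun ξ => hαQ.1 ⟨l, ξ, rfl⟩
  have hJ : ‖HGP.jacXY Q.inner (xs l) l‖ ≤ β :=
    HGP.Problem.norm_jacXY_inner_le hU fun ξ => hβQ.1 ⟨l, ξ, rfl⟩
  have hβ : 0 ≤ β := (norm_nonneg _).trans hJ
  obtain ⟨s, hsK, hs, hgrad⟩ := HGP.Problem.exists_hasGradientAt_outer hR hQ hxs hα hη.ne' l hH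
  refine ⟨hgrad.differentiableAt, fun S hS M => ?_⟩
  have hT : ∀ v, ‖v - η • HGP.hessX Q.inner (xs l) l v‖ ≤ (1 - η * α) * ‖v‖ := by
    refine HGP.norm_apply_le_of_isPositive hpos hq fun v => ?_
    have := mul_le_mul_of_nonneg_left (hH v) hη.le
    simp only [sub_apply, smul_apply, ContinuousLinearMap.id_apply, inner_sub_left,
      real_inner_smul_left, real_inner_self_eq_norm_sq]
    linarith
  -- The lower bound on S is exactly this, equivalently (1 - ηα)(1 + ε) ≤ 1 - ηα/2 with ε = nAτ^S.
  have hε : n * (A * τ ^ S) * (1 - η * α) ≤ η * α / 2 := by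
    have h1 := HGP.pow_le_of_log_div_log_le hτ0 hτ1 (by positivity) hS
    have h2 : 8 * √(n : ℝ) / (n * A) / (16 * √(n : ℝ)) * (η * α / (1 - η * α))
        = η * α / 2 / (n * A * (1 - η * α)) := by
      field_simp
      norm_num
    rw [h2, le_div_iff₀ (by positivity)] at h1
    linarith
  have hmain := HGP.norm_sum_sub_le_of_inexact_projection (K := HGP.consensus n dx) hηα hq.le hT
    (Pt := HGP.pushSumMap G S dx) (ε := n * (A * τ ^ S)) (by positivity)
    (HGP.norm_pushSumMap_sub_le (by positivity) (hW S)) (by linarith)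
    (U := Q.primal G η S (xs l) l) (HGP.Problem.primal_succ hR) hsK
    (by rw [HGP.Problem.primal_zero hR]; exact hs) M
  rw [HGP.Problem.primal_zero hR] at hmain
  rw [HGP.Problem.hyperGrad, hgrad.gradient, HGP.Problem.estimate_eq hR, sub_sub_sub_cancel_left,
    ← smul_sub, ← map_sub, norm_smul, Real.norm_of_nonneg hη.le, ← neg_sub, map_neg, norm_neg]
  have hexp : Real.exp (-(-Real.log (1 - η * α) * M)) = (1 - η * α) ^ M := by
    rw [neg_mul, neg_neg, mul_comm, ← Real.log_pow, Real.exp_log (by positivity)]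
  rw [hexp, abs_of_nonneg hβ]
  refine (mul_le_mul_of_nonneg_left ((ContinuousLinearMap.le_opNorm _ _).trans
    (mul_le_mul hJ hmain (norm_nonneg _) hβ)) hη.le).trans_eq ?_
  field_simp
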